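/- Let $d\ge 1$, let $\theta_0\ne\theta_1$ in $\mathbb R^d$, and let $\Sigma\in\mathbb R^{d\times d}$ be symmetric positive definite. Put $P_\infty=N(\theta_0,\Sigma)$ and $P_1=N(\theta_1,\Sigma)$, with densities $p_\infty,p_1$. For a density $q$ let $S_H(x,q)=\tfrac12\|\nabla\log q(x)\|^2+\Delta\log q(x)$ be its Hyvärinen score, and for $\lambda>0$ let $z_\lambda(x)=\lambda\,(S_H(x,p_\infty)-S_H(x,p_1))$. Let $$D_F=\tfrac12\,\mathbb E_{X\sim P_1}\|\nabla\log p_1(X)-\nabla\log p_\infty(X)\|^2$$ be the Fisher divergence of $P_1$ from $P_\infty$, and $D_{KL}=D_{KL}(P_1\|P_\infty)$ the Kullback--Leibler divergence. (a) $D_{KL}<\infty$, there is exactly one $\lambda>0$ with $\mathbb E_{X\sim P_\infty}[e^{z_\lambda(X)}]=1$, and for this $\lambda$ we have $\lambda D_F\le D_{KL}$, with equality if and only if $\theta_1-\theta_0$ is an eigenvector of $\Sigma$. (b) Suppose $\Sigma=\sigma_c I_d$ with $\sigma_c>0$, and let $\lambda>0$ satisfy $\mathbb E_{X\sim P_\infty}[e^{z_\lambda(X)}]=1$.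 Then $\lambda D_F=D_{KL}$. Moreover, let $X_1,X_2,\dots$ be observed sequentially, where for each change point $\nu\in\{1,2,\dots\}\cup\{\infty\}$, under the probability measure $\mathbb P_\nu$ (expectation $\mathbb E_\nu$), the $X_n$ are independent, with law $P_\infty$ for $n<\nu$ and law $P_1$ for $n\ge\nu$. Let $\mathcal F_n=\sigma(X_1,\dots,X_n)$. For a stopping time $T$ of $(\mathcal F_n)$ (with values in $\{0,1,2,\dots\}\cup\{\infty\}$) put $$\mathrm{WADD}(T)=\sup_{\nu\ge1}\operatorname{ess\,sup}\mathbb E_\nu[(T-\nu+1)^+\mid\mathcal F_\nu],\qquad \mathrm{CADD}(T)=\sup_{\nu\ge1}\mathbb E_\nu[T-\nu\mid T\ge\nu],$$ where $\nu$ ranges over the positive integers and, in the second supremum, over those with $\mathbb P_\nu(T\ge\nu)>0$. For $\tau>0$ let $T_\tau=\inf\{n\ge1:\max_{1\le k\le n}\sum_{i=k}^n z_\lambda(X_i)\ge\tau\}$ (with $\inf\emptyset=\infty$) be the SCUSUM rule. Then $T_\tau$ is a stopping time, $\mathbb E_\infty[T_{\log\gamma}]\ge\gamma$ for every $\gamma>1$,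 and for every choice of thresholds $\tau_\gamma$ such that, for all large $\gamma$, $0<\tau_\gamma\le\log\gamma$ and $\mathbb E_\infty[T_{\tau_\gamma}]\ge\gamma$ (in particular for $\tau_\gamma=\log\gamma$), $$\mathrm{WADD}(T_{\tau_\gamma})\sim\mathrm{CADD}(T_{\tau_\gamma})\sim\frac{\log\gamma}{D_{KL}(N(\theta_1,\Sigma)\|N(\theta_0,\Sigma))}\qquad(\gamma\to\infty),$$ and the SCUSUM rule is asymptotically optimal for Lorden's and for Pollak's problem: $$\mathrm{WADD}(T_{\tau_\gamma})\sim\inf_{T:\,\mathbb E_\infty[T]\ge\gamma}\mathrm{WADD}(T),\qquad \mathrm{CADD}(T_{\tau_\gamma})\sim\inf_{T:\,\mathbb E_\infty[T]\ge\gamma}\mathrm{CADD}(T),$$ the infima being over all stopping times $T$ of $(\mathcal F_n)$ with $\mathbb E_\infty[T]\ge\gamma$. Here $g\sim h$ means $g/h\to1$. -/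

import Mathlib

open MeasureTheory ProbabilityTheory Filter
open scoped ENNReal Topology Gradient Laplacian Matrix

namespace ScoreCusum

noncomputable section

/-! ### Gaussian densities, Hyvärinen score and Fisher divergence -/

/-- The Lebesgue density of `N(θ, S)` on `ℝᵈ`, for a positive definite covariance matrix `S`. -/
def gaussianDensity {d : ℕ} (θ : EuclideanSpace ℝ (Fin d)) (S : Matrix (Fin d) (Fin d) ℝ)
    (x : EuclideanSpace ℝ (Fin d)) : ℝ :=
  (Real.sqrt ((2 * Real.pi) ^ d * S.det))⁻¹ *
    Real.exp (-(1 / 2) * ((x - θ).ofLp ⬝ᵥ (S⁻¹ *ᵥ (x - θ).ofLp)))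

/-- The Hyvärinen score `S_H(x, q) = ½ ‖∇ log q(x)‖² + Δ log q(x)` of a density `q`. -/
def hyvarinenScore {d : ℕ} (q : EuclideanSpace ℝ (Fin d) → ℝ) (x : EuclideanSpace ℝ (Fin d)) : ℝ :=
  1 / 2 * ‖∇ (fun y => Real.log (q y)) x‖ ^ 2 + Δ (fun y => Real.log (q y)) x

/-- The Fisher divergence `D_F(P ‖ Q) = ½ 𝔼_{X ∼ P} ‖∇ log p(X) - ∇ log q(X)‖²`, where the laws
`P` and `Q` have densities `p` and `q`. With the factor `½` it is the divergence for which
`D_F(P ‖ Q) = 𝔼_{X ∼ P} [½ ‖∇ log p(X)‖² + S_H(X, q)]`. -/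
def fisherDivergence {d : ℕ} (P : Measure (EuclideanSpace ℝ (Fin d)))
    (p q : EuclideanSpace ℝ (Fin d) → ℝ) : ℝ :=
  1 / 2 * ∫ x, ‖∇ (fun y => Real.log (p y)) x - ∇ (fun y => Real.log (q y)) x‖ ^ 2 ∂P

/-- The instantaneous SCUSUM score `z_lam(x) = lam (S_H(x, p∞) - S_H(x, p₁))`, where `q₀ = p∞` is
the pre-change density and `q₁ = p₁` the post-change density. -/
def scusumScore {d : ℕ} (lam : ℝ) (q₀ q₁ : EuclideanSpace ℝ (Fin d) → ℝ)
    (x : EuclideanSpace ℝ (Fin d)) : ℝ :=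
  lam * (hyvarinenScore q₀ x - hyvarinenScore q₁ x)

/-- `z_lam` for the pre-change law `N(θ₀, S)` and the post-change law `N(θ₁, S)`. -/
def gaussianScore {d : ℕ} (lam : ℝ) (θ₀ θ₁ : EuclideanSpace ℝ (Fin d))
    (S : Matrix (Fin d) (Fin d) ℝ) : EuclideanSpace ℝ (Fin d) → ℝ :=
  scusumScore lam (gaussianDensity θ₀ S) (gaussianDensity θ₁ S)

/-- `𝔼_∞[exp z_lam(X)] = 1`. -/
def IsCalibrated {d : ℕ} (lam : ℝ) (θ₀ θ₁ : EuclideanSpace ℝ (Fin d))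
    (S : Matrix (Fin d) (Fin d) ℝ) : Prop :=
  ∫ x, Real.exp (gaussianScore lam θ₀ θ₁ S x) ∂(multivariateGaussian θ₀ S) = 1

/-- The Fisher divergence `D_F(N(θ₁, S) ‖ N(θ₀, S))`. -/
def gaussianFisher {d : ℕ} (θ₁ θ₀ : EuclideanSpace ℝ (Fin d)) (S : Matrix (Fin d) (Fin d) ℝ) : ℝ :=
  fisherDivergence (multivariateGaussian θ₁ S) (gaussianDensity θ₁ S) (gaussianDensity θ₀ S)

/-- The Kullback-Leibler divergence `D_KL(N(θ₁, S) ‖ N(θ₀, S))`, possibly `∞`. -/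
def gaussianKL {d : ℕ} (θ₁ θ₀ : EuclideanSpace ℝ (Fin d)) (S : Matrix (Fin d) (Fin d) ℝ) : ℝ≥0∞ :=
  InformationTheory.klDiv (multivariateGaussian θ₁ S) (multivariateGaussian θ₀ S)

/-! ### Quickest change detection

The observations are `X₁, X₂, …`; in the code `X i` is the observation `X_{i+1}`. -/

section Detection

variable {Ω E : Type*} {mΩ : MeasurableSpace Ω} {mE : MeasurableSpace E}

/-- Under `P ν` (with change point `ν ∈ {1, 2, …} ∪ {∞}`) the observations are independent,
`X₁, …, X_{ν-1}` have law `P₀` and `X_ν, X_{ν+1}, …` have law `P₁`; `P ⊤` is the no-change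
measure. -/
structure IsChangePointModel (P : ℕ∞ → Measure Ω) (X : ℕ → Ω → E) (P₀ P₁ : Measure E) : Prop where
  isProbabilityMeasure : ∀ ν, 1 ≤ ν → IsProbabilityMeasure (P ν)
  measurable : ∀ i, Measurable (X i)
  indep : ∀ ν, 1 ≤ ν → iIndepFun X (P ν)
  law_pre : ∀ ν, 1 ≤ ν → ∀ i : ℕ, ((i + 1 : ℕ) : ℕ∞) < ν → (P ν).map (X i) = P₀
  law_post : ∀ ν, 1 ≤ ν → ∀ i : ℕ, ν ≤ ((i + 1 : ℕ) : ℕ∞) → (P ν).map (X i) = P₁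

/-- The filtration `ℱ_n = σ(X₁, …, X_n)`; in particular `ℱ_0` is trivial. -/
def obsFiltration (X : ℕ → Ω → E) (hX : ∀ i, Measurable (X i)) :
    Filtration ℕ mΩ where
  seq n := ⨆ i : ℕ, ⨆ _ : i < n, MeasurableSpace.comap (X i) mE
  mono' _ _ hmn := iSup_mono fun _ => iSup_mono' fun hi => ⟨lt_of_lt_of_le hi hmn, le_rfl⟩
  le' _ := iSup_le fun i => iSup_le fun _ => (hX i).comap_le

/-- The stopping rule `T = inf {n ≥ 1 : max_{1 ≤ k ≤ n} ∑_{i=k}^n z(X_i) ≥ τ}`, with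
`inf ∅ = ∞`. (`Finset.Ico k n` in the code runs over the observations `X_{k+1}, …, X_n`.) -/
def cusumTime {Ω E : Type*} (z : E → ℝ) (X : ℕ → Ω → E) (τ : ℝ) (ω : Ω) : ℕ∞ :=
  ⨅ (n : ℕ) (_ : ∃ k, k < n ∧ τ ≤ ∑ i ∈ Finset.Ico k n, z (X i ω)), (n : ℕ∞)

/-- The mean time to false alarm `𝔼_∞[T]`. -/
def arl (P : ℕ∞ → Measure Ω) (T : Ω → ℕ∞) : ℝ≥0∞ :=
  ∫⁻ ω, (T ω : ℝ≥0∞) ∂(P ⊤)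

/-- Lorden's worst-case averaged detection delay
`sup_{ν ≥ 1} ess sup 𝔼_ν[(T - ν + 1)⁺ | ℱ_ν]`. (Subtraction in `ℝ≥0∞` is the positive part of
the difference.) -/
def wadd (P : ℕ∞ → Measure Ω) (ℱ : Filtration ℕ mΩ)
    (T : Ω → ℕ∞) : ℝ≥0∞ :=
  ⨆ (ν : ℕ) (_ : 1 ≤ ν),
    essSup (condLExp (ℱ ν) (P ν) fun ω => (T ω : ℝ≥0∞) + 1 - (ν : ℝ≥0∞)) (P ν)

/-- Pollak's worst conditional averaged detection delay `sup_{ν ≥ 1} 𝔼_ν[T - ν | T ≥ ν]`; change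
points `ν` with `P_ν(T ≥ ν) = 0` do not contribute. -/
def cadd (P : ℕ∞ → Measure Ω) (T : Ω → ℕ∞) : ℝ≥0∞ :=
  ⨆ (ν : ℕ) (_ : 1 ≤ ν),
    ∫⁻ ω, ((T ω : ℝ≥0∞) - (ν : ℝ≥0∞)) ∂(ProbabilityTheory.cond (P ν) {ω | (ν : ℕ∞) ≤ T ω})

/-- The minimal value of the delay criterion `L` over all stopping times `T` of the observations
with `𝔼_∞[T] ≥ γ`. -/
def optimalDelay (P : ℕ∞ → Measure Ω) (ℱ : Filtration ℕ mΩ)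
    (L : (Ω → ℕ∞) → ℝ≥0∞) (γ : ℝ) : ℝ≥0∞ :=
  ⨅ (T : Ω → ℕ∞) (_ : IsStoppingTime ℱ T ∧ ENNReal.ofReal γ ≤ arl P T), L T

end Detection

/-- The stopping rule `T_SCUSUM` with multiplier `lam` and threshold `τ`, for the pre-change law
`N(θ₀, S)` and the post-change law `N(θ₁, S)`. -/
def scusumTime {Ω : Type*} {d : ℕ} (lam : ℝ) (θ₀ θ₁ : EuclideanSpace ℝ (Fin d))
    (S : Matrix (Fin d) (Fin d) ℝ) (X : ℕ → Ω → EuclideanSpace ℝ (Fin d)) (τ : ℝ) : Ω → ℕ∞ :=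
  cusumTime (gaussianScore lam θ₀ θ₁ S) X τ

/-- `g(γ) ∼ h(γ)` as `γ → ∞`, that is, `g(γ) / h(γ) → 1`. -/
def AsympEquiv (g h : ℝ → ℝ≥0∞) : Prop :=
  Tendsto (fun γ => g γ / h γ) atTop (𝓝 1)

end

end ScoreCusum

/-! Write `δ = θ₁ - θ₀`, `B = S⁻¹`, `u = B δ`. The log densities differ by an affine function, so
their Laplacians agree and the quadratic parts of the squared gradients cancel. The score is
therefore affine: `lam * (⟪B u, x - θ₀⟫ - ‖u‖² / 2)` (`gaussianScore_eq`). The Gaussian exponential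
moment turns calibration into the linear equation `lam * ⟪u, B u⟫ = ‖u‖²`, which has exactly one
positive root. With `D_KL = ⟪u, δ⟫ / 2` and `D_F = ‖u‖² / 2`, that equation completes a square:
`D_KL - lam * D_F = ⟪w, B w⟫ / 2` for `w = δ - lam • u`. This is nonnegative, and it vanishes iff `δ
= lam • u`, that is, iff `S δ = lam • δ`.

For a scalar covariance every `δ` is an eigenvector, and then the calibrated score is exactly the
log-likelihood ratio. SCUSUM is thus CUSUM, and the rest uses only two facts about the score `z`:
the density of `P₁` with respect to `P₀` is `exp z`, and `z` has moment generating function `exp (D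
(s + s²))` under `P₁`, where `D = D_KL`.

The false alarm bound (`le_arl_cusumTime`) comes from dominating the threshold at an alarm by a sum
of likelihood ratios over all possible change points. The delay of CUSUM is bounded above by a
Chernoff estimate for the sum that starts just after the change (`wadd_cusumTime_le`). For an
arbitrary stopping time, a large mean time to false alarm yields a window of length `m` in which
stopping is unlikely without a change. A change of measure truncated at `exp c` makes it unlikely
after a change as well (`le_cadd`). Since `cadd ≤ wadd`, a lower bound on `cadd` for all rules and
an upper bound on `wadd` for CUSUM pin all four delays to `log γ / D`. -/

namespace ScoreCusum

/-! ### Products of measures with density -/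

/-- A product of measures with densities has the product density. -/
theorem pi_withDensity {ι : Type*} [Fintype ι] {α : ι → Type*} [∀ i, MeasurableSpace (α i)]
    (μ : ∀ i, Measure (α i)) [∀ i, IsProbabilityMeasure (μ i)] (f : ∀ i, α i → ℝ≥0∞)
    (hf : ∀ i, Measurable (f i)) [∀ i, SigmaFinite ((μ i).withDensity (f i))] :
    Measure.pi (fun i => (μ i).withDensity (f i)) =
      (Measure.pi μ).withDensity fun x => ∏ i, f i (x i) := by
  refine Measure.pi_eq fun s hs => ?_
  -- Restricting each density to its side of the box makes the integrand a product of functions of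
  -- single coordinates, which are independent under `Measure.pi μ`.
  have hind : iIndepFun (fun i (x : ∀ i, α i) => (s i).indicator (f i) (x i)) (Measure.pi μ) :=
    iIndepFun_pi fun i => ((hf i).indicator (hs i)).aemeasurable
  have hm : ∀ i, Measurable fun x : ∀ i, α i => (s i).indicator (f i) (x i) := fun i =>
    ((hf i).indicator (hs i)).comp (measurable_pi_apply i)
  have hprod := lintegral_prod_eq_prod_lintegral_of_indepFun Finset.univ _ hind hm
  rw [withDensity_apply _ (MeasurableSet.univ_pi hs), ← lintegral_indicator (.univ_pi hs)]
  trans ∫⁻ x, ∏ i, (s i).indicator (f i) (x i) ∂(Measure.pi μ)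
  · refine lintegral_congr fun x => ?_
    by_cases hx : x ∈ Set.univ.pi s
    · rw [Set.indicator_of_mem hx]
      exact Finset.prod_congr rfl fun i _ => (Set.indicator_of_mem (hx i trivial) _).symm
    · rw [Set.indicator_of_notMem hx]
      obtain ⟨i, hi⟩ : ∃ i, x i ∉ s i := by simpa [Set.mem_pi] using hx
      exact (Finset.prod_eq_zero (Finset.mem_univ i) (Set.indicator_of_notMem hi _)).symm
  · rw [hprod]
    refine Finset.prod_congr rfl fun i _ => ?_
    rw [withDensity_apply _ (hs i), ← lintegral_indicator (hs i)]
    exact (measurePreserving_eval μ i).lintegral_comp ((hf i).indicator (hs i))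

/-- Pushing forward a density that factors through the map. -/
theorem map_withDensity_comp {α β : Type*} [MeasurableSpace α] [MeasurableSpace β]
    (μ : Measure α) {f : α → β} (hf : Measurable f) {g : β → ℝ≥0∞} (hg : Measurable g) :
    (μ.withDensity (g ∘ f)).map f = (μ.map f).withDensity g := by
  ext s hs
  rw [Measure.map_apply hf hs, withDensity_apply _ (hf hs), withDensity_apply _ hs,
    setLIntegral_map hs hg hf]
  rfl

/-! ### Independence and change of measure in the change-point model -/

section Detection

variable {Ω E : Type*} {mΩ : MeasurableSpace Ω} {mE : MeasurableSpace E}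

/-- An event of the past is a preimage under the finite vector of observations. In this form both
block independence and the law of the vector apply. -/
theorem obsFiltration_eq_comap (X : ℕ → Ω → E) (hX : ∀ i, Measurable (X i)) (n : ℕ) :
    obsFiltration X hX n =
      MeasurableSpace.comap (fun ω (i : Finset.range n) => X i ω) MeasurableSpace.pi := by
  simp only [obsFiltration, MeasurableSpace.pi, MeasurableSpace.comap_iSup,
    MeasurableSpace.comap_comp]
  refine le_antisymm (iSup₂_le fun i hi => ?_) (iSup_le fun i => ?_)
  · exact le_iSup_of_le (⟨i, Finset.mem_range.2 hi⟩ : Finset.range n) le_rfl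
  · exact le_iSup₂_of_le (i : ℕ) (Finset.mem_range.1 i.2) le_rfl

theorem measurable_obsFiltration (X : ℕ → Ω → E) (hX : ∀ i, Measurable (X i)) {i n : ℕ}
    (hi : i < n) : Measurable[obsFiltration X hX n] (X i) :=
  Measurable.of_comap_le (le_iSup₂_of_le (f := fun (i : ℕ) (_ : i < n) =>
    MeasurableSpace.comap (X i) mE) i hi le_rfl)

variable {P : ℕ∞ → Measure Ω} {X : ℕ → Ω → E} {P₀ P₁ : Measure E}

/-- The past is independent of products over later observations. -/
theorem IsChangePointModel.setLIntegral_prod (hM : IsChangePointModel P X P₀ P₁) {ν : ℕ∞}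
    (hν : 1 ≤ ν) {n N : ℕ} {A : Set Ω} (hA : MeasurableSet[obsFiltration X hM.measurable n] A)
    {f : E → ℝ≥0∞} (hf : Measurable f) :
    ∫⁻ ω in A, ∏ i ∈ Finset.Ico n N, f (X i ω) ∂(P ν) =
      P ν A * ∏ i ∈ Finset.Ico n N, ∫⁻ x, f x ∂((P ν).map (X i)) := by
  have hA' := (obsFiltration X hM.measurable).le n A hA
  have hdisj : Disjoint (Finset.range n) (Finset.Ico n N) := by
    rw [Finset.disjoint_left]
    intro a ha hb
    simp only [Finset.mem_range, Finset.mem_Ico] at ha hb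
    omega
  have hind := iIndepFun.indepFun_finset _ _ hdisj (hM.indep ν hν) hM.measurable
  have hmeas := hM.measurable
  have hf1 : Measurable[MeasurableSpace.comap (fun ω (i : Finset.range n) => X i ω)
      MeasurableSpace.pi] (A.indicator (1 : Ω → ℝ≥0∞)) := by
    rw [← obsFiltration_eq_comap X hM.measurable]
    exact (@measurable_one _ _ _ (_) _).indicator hA
  have hf2 : Measurable[MeasurableSpace.comap (fun ω (i : Finset.Ico n N) => X i ω)
      MeasurableSpace.pi] (fun ω => ∏ i ∈ Finset.Ico n N, f (X i ω)) := by
    have h : Measurable fun x : Finset.Ico n N → E => ∏ i, f (x i) := by fun_prop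
    have h' := h.comp (comap_measurable fun ω (i : Finset.Ico n N) => X i ω)
    convert h' using 2 with ω
    exact (Finset.prod_coe_sort (Finset.Ico n N) fun i => f (X i ω)).symm
  have key := lintegral_mul_eq_lintegral_mul_lintegral_of_independent_measurableSpace
    (measurable_iff_comap_le.1 (by fun_prop)) (measurable_iff_comap_le.1 (by fun_prop))
    hind hf1 hf2
  rw [lintegral_indicator_one hA'] at key
  rw [← lintegral_indicator hA']
  calc _ = ∫⁻ ω, A.indicator 1 ω * ∏ i ∈ Finset.Ico n N, f (X i ω) ∂(P ν) := by
        refine lintegral_congr fun ω => ?_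
        by_cases h : ω ∈ A <;> simp [h]
    _ = _ := by
      rw [key, lintegral_prod_eq_prod_lintegral_of_indepFun (Finset.Ico n N)
        (fun i ω => f (X i ω)) ((hM.indep ν hν).comp (fun _ => f) fun _ => hf)
        fun i => hf.comp (hM.measurable i)]
      congr 1
      exact Finset.prod_congr rfl fun i _ => (lintegral_map hf (hM.measurable i)).symm

theorem IsChangePointModel.map_post (hM : IsChangePointModel P X P₀ P₁) {k i : ℕ} (h : k ≤ i) :
    (P (k + 1 : ℕ)).map (X i) = P₁ :=
  hM.law_post _ (by simp) i (by exact_mod_cast Nat.succ_le_succ h)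

theorem IsChangePointModel.map_pre (hM : IsChangePointModel P X P₀ P₁) {k i : ℕ} (h : i < k) :
    (P (k + 1 : ℕ)).map (X i) = P₀ :=
  hM.law_pre _ (by simp) i (by exact_mod_cast Nat.succ_lt_succ h)

theorem IsChangePointModel.map_top (hM : IsChangePointModel P X P₀ P₁) (i : ℕ) :
    (P ⊤).map (X i) = P₀ :=
  hM.law_pre _ le_top i (ENat.natCast_lt_top _)

theorem IsChangePointModel.isProbabilityMeasure_pre (hM : IsChangePointModel P X P₀ P₁) :
    IsProbabilityMeasure P₀ := by
  have := hM.isProbabilityMeasure ⊤ le_top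
  rw [← hM.map_top 0]
  exact Measure.isProbabilityMeasure_map (hM.measurable 0).aemeasurable

theorem IsChangePointModel.isProbabilityMeasure_post (hM : IsChangePointModel P X P₀ P₁) :
    IsProbabilityMeasure P₁ := by
  have := hM.isProbabilityMeasure (0 + 1 : ℕ) (by simp)
  rw [← hM.map_post (le_refl 0)]
  exact Measure.isProbabilityMeasure_map (hM.measurable 0).aemeasurable

theorem IsChangePointModel.map_range (hM : IsChangePointModel P X P₀ P₁) {ν : ℕ∞}
    (hν : 1 ≤ ν) (N : ℕ) :
    (P ν).map (fun ω (i : Finset.range N) => X i ω) =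
      Measure.pi fun i : Finset.range N => (P ν).map (X i) := by
  have := hM.isProbabilityMeasure ν hν
  exact (iIndepFun_iff_map_fun_eq_pi_map (f := fun (i : Finset.range N) => X i)
    fun i => (hM.measurable i).aemeasurable).1
    ((hM.indep ν hν).precomp Subtype.val_injective)

/-- The likelihood ratio of the observations up to time `N`. -/
theorem IsChangePointModel.apply_eq_setLIntegral (hM : IsChangePointModel P X P₀ P₁)
    {l : E → ℝ≥0∞} (hl : Measurable l) (hP : P₁ = P₀.withDensity l) {k N : ℕ} {A : Set Ω}
    (hA : MeasurableSet[obsFiltration X hM.measurable N] A) :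
    P (k + 1 : ℕ) A = ∫⁻ ω in A, ∏ i ∈ Finset.Ico k N, l (X i ω) ∂(P ⊤) := by
  have := hM.isProbabilityMeasure_pre
  have := hM.isProbabilityMeasure_post
  have hmeas : Measurable fun ω (i : Finset.range N) => X i ω :=
    measurable_pi_lambda _ fun i => hM.measurable i
  rw [obsFiltration_eq_comap] at hA
  obtain ⟨B, hB, rfl⟩ := hA
  -- Under change point `k + 1` the coordinate `X i` has density `l` for `i ≥ k` and density `1`
  -- before; the product of these is the likelihood ratio.
  let f : Finset.range N → E → ℝ≥0∞ := fun i => if k ≤ i then l else 1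
  have hf : ∀ i, Measurable (f i) := fun i => by
    by_cases h : k ≤ (i : ℕ)
    · simpa [f, h] using hl
    · simpa [f, h] using measurable_one
  have hlaw : ∀ i : Finset.range N, (P (k + 1 : ℕ)).map (X i) = P₀.withDensity (f i) := fun i => by
    by_cases h : k ≤ (i : ℕ)
    · simp only [f, h, if_true, hM.map_post h, hP]
    · simp only [f, h, if_false, hM.map_pre (not_le.1 h), withDensity_one]
  have hsf : ∀ i, SigmaFinite (P₀.withDensity (f i)) := fun i => by
    rw [← hlaw]
    have := hM.isProbabilityMeasure (k + 1 : ℕ) (by simp)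
    have := Measure.isProbabilityMeasure_map (μ := P (k + 1 : ℕ)) (hM.measurable i).aemeasurable
    infer_instance
  rw [← Measure.map_apply hmeas hB, hM.map_range (by simp)]
  simp_rw [hlaw]
  rw [pi_withDensity (fun _ => P₀) f hf, withDensity_apply _ hB]
  have htop : Measure.pi (fun _ : Finset.range N => P₀) =
      (P ⊤).map (fun ω (i : Finset.range N) => X i ω) := by
    rw [hM.map_range le_top]
    simp_rw [hM.map_top]
  rw [htop, setLIntegral_map hB (by fun_prop) hmeas]
  refine lintegral_congr fun ω => ?_
  have h1 : ∀ i : Finset.range N, f i (X i ω) = if k ≤ (i : ℕ) then l (X i ω) else 1 := fun i => by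
    by_cases h : k ≤ (i : ℕ) <;> simp [f, h]
  simp_rw [h1]
  rw [Finset.prod_coe_sort (Finset.range N) fun i => if k ≤ i then l (X i ω) else 1,
    ← Finset.prod_filter]
  congr 1
  ext i
  simp [and_comm]

/-- The likelihood ratio up to time `k` is an empty product: the change has not yet been observed.
-/
theorem IsChangePointModel.apply_eq_top (hM : IsChangePointModel P X P₀ P₁)
    {l : E → ℝ≥0∞} (hl : Measurable l) (hP : P₁ = P₀.withDensity l) {k : ℕ} {A : Set Ω}
    (hA : MeasurableSet[obsFiltration X hM.measurable k] A) : P (k + 1 : ℕ) A = P ⊤ A := by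
  rw [hM.apply_eq_setLIntegral hl hP hA]
  simp

/-! ### Extended natural numbers as sums of indicators -/

theorem enat_eq_tsum (t : ℕ∞) : (t : ℝ≥0∞) = ∑' j : ℕ, if (j : ℕ∞) < t then 1 else 0 := by
  induction t with
  | top => simp
  | coe n =>
    rw [tsum_eq_sum (s := Finset.range n) fun j hj => by
      rw [if_neg]; simpa using hj]
    rw [Finset.sum_congr rfl (g := fun _ => (1 : ℝ≥0∞)) fun j hj => by
      rw [if_pos]; simpa using hj]
    simp

theorem enat_le_add_tsum (t : ℕ∞) (k : ℕ) :
    (t : ℝ≥0∞) ≤ k + ∑' j : ℕ, if ((k + j : ℕ) : ℕ∞) < t then 1 else 0 := by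
  rw [enat_eq_tsum, ← Summable.sum_add_tsum_nat_add' (k := k) ENNReal.summable]
  simp_rw [add_comm k]
  gcongr
  calc _ ≤ ∑ _j ∈ Finset.range k, (1 : ℝ≥0∞) := by
        gcongr with j
        split_ifs <;> simp
    _ = k := by simp

/-! ### Stopping times -/

theorem measurableSet_lt_of_isStoppingTime {ℱ : Filtration ℕ mΩ} {T : Ω → ℕ∞}
    (hT : IsStoppingTime ℱ T) (n : ℕ) : MeasurableSet[ℱ n] {ω | (n : ℕ∞) < T ω} := by
  have h := (hT n).compl
  convert! h using 1
  ext ω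
  exact (not_le (a := T ω) (b := (n : ℕ∞))).symm

theorem arl_eq_tsum {ℱ : Filtration ℕ mΩ} {T : Ω → ℕ∞} (hT : IsStoppingTime ℱ T) :
    arl P T = ∑' j : ℕ, P ⊤ {ω | (j : ℕ∞) < T ω} := by
  have hm := fun j => ℱ.le j _ (measurableSet_lt_of_isStoppingTime hT j)
  simp_rw [arl, enat_eq_tsum]
  rw [lintegral_tsum fun j => (Measurable.ite (hm j) measurable_const measurable_const).aemeasurable]
  refine tsum_congr fun j => ?_
  rw [← lintegral_indicator_one (hm j)]
  refine lintegral_congr fun ω => ?_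
  simp [Set.indicator_apply]

/-! ### The CUSUM rule -/

theorem cusumTime_le_iff (z : E → ℝ) (X : ℕ → Ω → E) (τ : ℝ) (ω : Ω) (n : ℕ) :
    cusumTime z X τ ω ≤ n ↔ ∃ m ≤ n, ∃ k < m, τ ≤ ∑ i ∈ Finset.Ico k m, z (X i ω) := by
  constructor
  · intro h
    have h' : cusumTime z X τ ω < (n + 1 : ℕ) :=
      h.trans_lt (by exact_mod_cast Nat.lt_succ_self n)
    simp only [cusumTime, iInf_lt_iff] at h'
    obtain ⟨m, ⟨k, hk, hs⟩, hm⟩ := h'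
    exact ⟨m, Nat.lt_succ_iff.1 (by exact_mod_cast hm), k, hk, hs⟩
  · rintro ⟨m, hm, k, hk, hs⟩
    exact (iInf₂_le (f := fun (n : ℕ) (_ : ∃ k, k < n ∧ τ ≤ ∑ i ∈ Finset.Ico k n, z (X i ω)) =>
      (n : ℕ∞)) m ⟨k, hk, hs⟩).trans (by exact_mod_cast hm)

theorem exists_le_sum_of_cusumTime_eq {z : E → ℝ} {X : ℕ → Ω → E} {τ : ℝ} {ω : Ω} {n : ℕ}
    (h : cusumTime z X τ ω = n) : ∃ k < n, τ ≤ ∑ i ∈ Finset.Ico k n, z (X i ω) := by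
  obtain ⟨m, hm, k, hk, hs⟩ := (cusumTime_le_iff z X τ ω n).1 h.le
  have : cusumTime z X τ ω ≤ m := (cusumTime_le_iff z X τ ω m).2 ⟨m, le_rfl, k, hk, hs⟩
  rw [h] at this
  obtain rfl : m = n := le_antisymm hm (by exact_mod_cast this)
  exact ⟨k, hk, hs⟩

theorem isStoppingTime_cusumTime {z : E → ℝ} (hz : Measurable z)
    (hX : ∀ i, Measurable (X i)) (τ : ℝ) :
    IsStoppingTime (obsFiltration X hX) (cusumTime z X τ) := by
  intro n
  have : {ω | cusumTime z X τ ω ≤ n} =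
      ⋃ m ∈ Finset.range (n + 1), ⋃ k ∈ Finset.range m,
        {ω | τ ≤ ∑ i ∈ Finset.Ico k m, z (X i ω)} := by
    ext ω
    simp only [Set.mem_ofPred_eq, cusumTime_le_iff, Set.mem_iUnion, Finset.mem_range, exists_prop,
      Nat.lt_succ_iff]
  change MeasurableSet[obsFiltration X hX n] {ω | cusumTime z X τ ω ≤ n}
  rw [this]
  refine Finset.measurableSet_biUnion _ fun m hm => Finset.measurableSet_biUnion _ fun k _ => ?_
  have hsum : Measurable[obsFiltration X hX n] fun ω => ∑ i ∈ Finset.Ico k m, z (X i ω) := ?_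
  · exact hsum measurableSet_Ici
  refine Finset.measurable_sum _ fun i hi => hz.comp (measurable_obsFiltration X hX ?_)
  simp only [Finset.mem_range, Finset.mem_Ico] at hm hi
  omega

/-- Lorden's bound: the CUSUM rule for the log-likelihood ratio with threshold `log γ` has mean
time to false alarm at least `γ`. -/
theorem IsChangePointModel.le_arl_cusumTime (hM : IsChangePointModel P X P₀ P₁)
    {z : E → ℝ} (hz : Measurable z)
    (hP : P₁ = P₀.withDensity fun x => ENNReal.ofReal (Real.exp (z x))) {γ : ℝ} (hγ : 0 < γ) :
    ENNReal.ofReal γ ≤ arl P (cusumTime z X (Real.log γ)) := by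
  have hT := isStoppingTime_cusumTime hz hM.measurable (Real.log γ)
  set T := cusumTime z X (Real.log γ) with hTdef
  set ℱ := obsFiltration X hM.measurable
  have hl : Measurable fun x => ENNReal.ofReal (Real.exp (z x)) := by fun_prop
  have := hM.isProbabilityMeasure ⊤ le_top
  have hmeq : ∀ n : ℕ, MeasurableSet {ω | T ω = n} := fun n =>
    ℱ.le n _ (hT.measurableSet_eq n)
  -- If `T = ⊤` has positive probability, `arl` is infinite. Otherwise the events `T = n` carry all
  -- the mass.
  by_cases htop : P ⊤ {ω | T ω = ⊤} = 0
  swap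
  · have hmt : MeasurableSet {ω | T ω = ⊤} := by
      have : {ω | T ω = ⊤} = (⋃ n : ℕ, {ω | T ω = n})ᶜ := by
        ext ω
        simp only [Set.mem_ofPred_eq, Set.mem_compl_iff, Set.mem_iUnion, not_exists]
        exact ⟨fun h n => by simp [h], fun h => by
          by_contra h'
          obtain ⟨n, hn⟩ := ENat.ne_top_iff_exists.1 h'
          exact h n hn.symm⟩
      rw [this]
      exact (MeasurableSet.iUnion hmeq).compl
    have : arl P T = ⊤ := by
      refine top_le_iff.1 ?_
      calc ⊤ = ∫⁻ _ω in {ω | T ω = ⊤}, ⊤ ∂(P ⊤) := by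
            rw [setLIntegral_const, ENNReal.top_mul htop]
        _ = ∫⁻ ω in {ω | T ω = ⊤}, (T ω : ℝ≥0∞) ∂(P ⊤) :=
            setLIntegral_congr_fun hmt fun ω hω => by simp [hω.out]
        _ ≤ _ := setLIntegral_le_lintegral _ _
    simp [this]
  have hfin : 1 = ∑' n : ℕ, P ⊤ {ω | T ω = n} := by
    rw [← measure_iUnion _ hmeq]
    · rw [← measure_univ (μ := P ⊤)]
      refine measure_congr ?_
      have : ∀ᵐ ω ∂(P ⊤), T ω ≠ ⊤ := measure_eq_zero_iff_ae_notMem.1 htop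
      filter_upwards [this] with ω hω
      obtain ⟨n, hn⟩ := ENat.ne_top_iff_exists.1 hω
      refine propext ⟨fun _ => ?_, fun _ => trivial⟩
      exact Set.mem_iUnion.2 ⟨n, hn.symm⟩
    · intro m n hmn
      refine Set.disjoint_left.2 fun ω (h1 : T ω = m) (h2 : T ω = n) => hmn ?_
      exact_mod_cast h1.symm.trans h2
  -- At an alarm some sum reaches `log γ`, so the likelihood ratio from the corresponding `k` is at
  -- least `γ`. The sum over all `k < n` dominates it without singling out the random `k`.
  have hstep : ∀ n : ℕ, ENNReal.ofReal γ * P ⊤ {ω | T ω = n} ≤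
      ∑' k : ℕ, if k < n then P (k + 1 : ℕ) {ω | T ω = n} else 0 := by
    intro n
    rw [tsum_eq_sum (s := Finset.range n) fun k hk => by
      rw [if_neg]; simpa using hk]
    rw [← setLIntegral_const]
    calc _ ≤ ∫⁻ ω in {ω | T ω = n}, ∑ k ∈ Finset.range n, ∏ i ∈ Finset.Ico k n,
          ENNReal.ofReal (Real.exp (z (X i ω))) ∂(P ⊤) := by
          refine setLIntegral_mono' (hmeq n) fun ω hω => ?_
          obtain ⟨k, hk, hs⟩ := exists_le_sum_of_cusumTime_eq hω.out
          calc ENNReal.ofReal γ ≤ ENNReal.ofReal (Real.exp (∑ i ∈ Finset.Ico k n, z (X i ω))) := by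
                refine ENNReal.ofReal_le_ofReal ?_
                rw [← Real.exp_log hγ]
                exact Real.exp_le_exp.2 hs
            _ = ∏ i ∈ Finset.Ico k n, ENNReal.ofReal (Real.exp (z (X i ω))) := by
                rw [Real.exp_sum, ENNReal.ofReal_prod_of_nonneg fun i _ => (Real.exp_pos _).le]
            _ ≤ _ := Finset.single_le_sum (f := fun k => ∏ i ∈ Finset.Ico k n,
                ENNReal.ofReal (Real.exp (z (X i ω)))) (fun _ _ => zero_le) (Finset.mem_range.2 hk)
      _ = ∑ k ∈ Finset.range n, P (k + 1 : ℕ) {ω | T ω = n} := by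
          rw [lintegral_finsetSum]
          · refine Finset.sum_congr rfl fun k _ => ?_
            exact (hM.apply_eq_setLIntegral hl hP (hT.measurableSet_eq n)).symm
          · intro k _
            have := hM.measurable
            fun_prop
      _ ≤ _ := by
          gcongr with k hk
          rw [if_pos (Finset.mem_range.1 hk)]
  calc ENNReal.ofReal γ = ∑' n : ℕ, ENNReal.ofReal γ * P ⊤ {ω | T ω = n} := by
        rw [ENNReal.tsum_mul_left, ← hfin, mul_one]
    _ ≤ ∑' n : ℕ, ∑' k : ℕ, if k < n then P (k + 1 : ℕ) {ω | T ω = n} else 0 :=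
        ENNReal.tsum_le_tsum hstep
    _ = ∑' k : ℕ, ∑' n : ℕ, if k < n then P (k + 1 : ℕ) {ω | T ω = n} else 0 :=
        ENNReal.tsum_comm
    _ ≤ ∑' k : ℕ, P ⊤ {ω | (k : ℕ∞) < T ω} := by
        refine ENNReal.tsum_le_tsum fun k => ?_
        -- Summed over `n`, the events `T = n` with `k < n` lie in `{k < T}`, which is decided at
        -- time `k` and so has the same probability under `P ⊤`.
        rw [← hM.apply_eq_top hl hP (measurableSet_lt_of_isStoppingTime hT k)]
        have h1 : ∀ n : ℕ, (if k < n then P (k + 1 : ℕ) {ω | T ω = n} else 0) =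
            P (k + 1 : ℕ) {ω | k < n ∧ T ω = n} := fun n => by
          by_cases h : k < n <;> simp [h]
        simp_rw [h1]
        rw [← measure_iUnion]
        · refine measure_mono fun ω hω => ?_
          obtain ⟨n, hn, hT⟩ := Set.mem_iUnion.1 hω
          change (k : ℕ∞) < T ω
          rw [hT]
          exact_mod_cast hn
        · intro m n hmn
          refine Set.disjoint_left.2 fun ω h1 h2 => hmn ?_
          exact_mod_cast h1.2.symm.trans h2.2
        · intro n
          exact (MeasurableSet.const _).inter (hmeq n)
    _ = arl P T := (arl_eq_tsum hT).symm

/-! ### Comparison of the delay criteria -/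

/-- The event `{ν ≤ T}` belongs to `ℱ ν`, so the conditional delay is an average of the conditional
expectation over that event and cannot exceed its essential supremum. -/
theorem IsChangePointModel.cadd_le_wadd (hM : IsChangePointModel P X P₀ P₁) {T : Ω → ℕ∞}
    (hT : IsStoppingTime (obsFiltration X hM.measurable) T) :
    cadd P T ≤ wadd P (obsFiltration X hM.measurable) T := by
  set ℱ := obsFiltration X hM.measurable
  refine iSup₂_mono fun ν hν => ?_
  have := hM.isProbabilityMeasure ν (by exact_mod_cast hν)
  set A := {ω | (ν : ℕ∞) ≤ T ω}
  have hA : MeasurableSet[ℱ ν] A := hT.measurableSet_ge ν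
  have hA' : MeasurableSet A := ℱ.le ν _ hA
  by_cases h0 : P ν A = 0
  · rw [ProbabilityTheory.cond, lintegral_smul_measure, Measure.restrict_eq_zero.2 h0]
    simp
  rw [ProbabilityTheory.cond, lintegral_smul_measure, smul_eq_mul]
  set S := essSup (condLExp (ℱ ν) (P ν) fun ω => (T ω : ℝ≥0∞) + 1 - (ν : ℝ≥0∞)) (P ν)
  calc (P ν A)⁻¹ * ∫⁻ ω in A, ((T ω : ℝ≥0∞) - (ν : ℝ≥0∞)) ∂(P ν)
      ≤ (P ν A)⁻¹ * ∫⁻ ω in A, ((T ω : ℝ≥0∞) + 1 - (ν : ℝ≥0∞)) ∂(P ν) := by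
        gcongr
        exact le_self_add
    _ = (P ν A)⁻¹ * ∫⁻ ω in A, condLExp (ℱ ν) (P ν)
          (fun ω => (T ω : ℝ≥0∞) + 1 - (ν : ℝ≥0∞)) ω ∂(P ν) := by
        rw [setLIntegral_condLExp (ℱ.le ν) _ _ hA]
    _ ≤ (P ν A)⁻¹ * ∫⁻ _ω in A, S ∂(P ν) := by
        gcongr 1
        exact lintegral_mono_ae (ae_restrict_of_ae (ENNReal.ae_le_essSup _))
    _ = S := by
        rw [setLIntegral_const, mul_comm S, ← mul_assoc,
          ENNReal.inv_mul_cancel h0 (measure_ne_top _ _), one_mul]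

/-- A bound on the integrals over the events of the past bounds the worst-case delay. -/
theorem IsChangePointModel.wadd_le (hM : IsChangePointModel P X P₀ P₁) {T : Ω → ℕ∞} {C : ℝ≥0∞}
    (h : ∀ ν : ℕ, 1 ≤ ν → ∀ A, MeasurableSet[obsFiltration X hM.measurable ν] A →
      ∫⁻ ω in A, ((T ω : ℝ≥0∞) + 1 - (ν : ℝ≥0∞)) ∂(P ν) ≤ C * P ν A) :
    wadd P (obsFiltration X hM.measurable) T ≤ C := by
  set ℱ := obsFiltration X hM.measurable
  refine iSup₂_le fun ν hν => essSup_le_of_ae_le _ ?_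
  have := hM.isProbabilityMeasure ν (by exact_mod_cast hν)
  have hm := measurable_condLExp (ℱ ν) (P ν) fun ω => (T ω : ℝ≥0∞) + 1 - (ν : ℝ≥0∞)
  -- The conditional expectation is `ℱ ν`-measurable, so under the trimmed measure it suffices to
  -- compare integrals over events of `ℱ ν`.
  refine ae_le_of_ae_le_trim (hm := ℱ.le ν) ?_
  refine ae_le_of_forall_setLIntegral_le_of_sigmaFinite hm fun A hA _ => ?_
  rw [setLIntegral_condLExp_trim _ _ _ hA, setLIntegral_const, trim_measurableSet_eq (ℱ.le ν) hA]
  exact h ν hν A hA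

/-! ### Upper bound for the delay of the CUSUM rule -/

/-- The first `⌈b / a⌉₊` terms are bounded by `1`; the later ones are dominated by a geometric
series of ratio `exp (-a)`. -/
theorem tsum_min_one_exp_le {a b : ℝ} (ha : 0 < a) (hb : 0 ≤ b) :
    ∑' j : ℕ, min 1 (ENNReal.ofReal (Real.exp (b - a * j))) ≤
      ENNReal.ofReal (b / a + 1 + (1 - Real.exp (-a))⁻¹) := by
  have hba : 0 ≤ b / a := by positivity
  have he : Real.exp (-a) < 1 := by simpa using ha
  have hK : b ≤ a * ⌈b / a⌉₊ := by
    have := Nat.le_ceil (b / a)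
    rw [div_le_iff₀ ha] at this
    linarith
  rw [← Summable.sum_add_tsum_nat_add' (k := ⌈b / a⌉₊) ENNReal.summable,
    ENNReal.ofReal_add (by positivity) (inv_nonneg.2 (by linarith))]
  refine add_le_add ?_ ?_
  · calc _ ≤ ∑ _j ∈ Finset.range ⌈b / a⌉₊, (1 : ℝ≥0∞) :=
          Finset.sum_le_sum fun _ _ => min_le_left _ _
      _ = ENNReal.ofReal (⌈b / a⌉₊ : ℝ) := by simp
      _ ≤ _ := ENNReal.ofReal_le_ofReal (Nat.ceil_lt_add_one hba).le
  · calc _ ≤ ∑' i : ℕ, (ENNReal.ofReal (Real.exp (-a))) ^ i := by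
          refine ENNReal.tsum_le_tsum fun i => (min_le_right _ _).trans ?_
          rw [← ENNReal.ofReal_pow (Real.exp_pos _).le, ← Real.exp_nat_mul]
          refine ENNReal.ofReal_le_ofReal (Real.exp_le_exp.2 ?_)
          push_cast
          nlinarith
      _ = _ := by
          rw [ENNReal.tsum_geometric, ENNReal.ofReal_inv_of_pos (by linarith),
            ENNReal.ofReal_sub _ (Real.exp_pos _).le, ENNReal.ofReal_one]

/-- If CUSUM has not stopped, every partial sum is at most `τ`, in particular the one that starts
after the past. That sum is independent of the past, and its exponential moment at `-s` gives the
tail `exp (s τ - a j)`, uniformly in the past event. -/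
theorem IsChangePointModel.wadd_cusumTime_le (hM : IsChangePointModel P X P₀ P₁)
    {z : E → ℝ} (hz : Measurable z) {s a τ : ℝ} (hs : 0 < s) (ha : 0 < a) (hτ : 0 ≤ τ)
    (hmgf : ∫⁻ x, ENNReal.ofReal (Real.exp (-s * z x)) ∂P₁ = ENNReal.ofReal (Real.exp (-a))) :
    wadd P (obsFiltration X hM.measurable) (cusumTime z X τ) ≤
      ENNReal.ofReal (1 + (s * τ / a + 1 + (1 - Real.exp (-a))⁻¹)) := by
  have he : Real.exp (-a) < 1 := by simpa using ha
  have hmX := hM.measurable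
  have hT := isStoppingTime_cusumTime hz hM.measurable τ
  set T := cusumTime z X τ with hTdef
  set ℱ := obsFiltration X hM.measurable
  rw [ENNReal.ofReal_add zero_le_one (by have := inv_nonneg.2 (sub_nonneg.2 he.le); positivity),
    ENNReal.ofReal_one]
  refine (hM.wadd_le (C := 1 + ∑' j : ℕ, min 1 (ENNReal.ofReal (Real.exp (s * τ - a * j)))) ?_).trans
    (add_le_add le_rfl (tsum_min_one_exp_le ha (by positivity)))
  intro ν hν A hA
  have hA' : MeasurableSet A := ℱ.le ν A hA
  obtain ⟨k, rfl⟩ : ∃ k, ν = k + 1 := ⟨ν - 1, by omega⟩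
  set Q := P ((k + 1 : ℕ) : ℕ∞) with hQ
  have hmset : ∀ j : ℕ, MeasurableSet {ω | ((k + 1 + j : ℕ) : ℕ∞) < T ω} := fun j =>
    ℱ.le _ _ (measurableSet_lt_of_isStoppingTime hT _)
  have hmite : ∀ j : ℕ, Measurable fun ω =>
      if ((k + 1 + j : ℕ) : ℕ∞) < T ω then (1 : ℝ≥0∞) else 0 := fun j =>
    Measurable.ite (hmset j) measurable_const measurable_const
  -- `ℱ ν` already contains the first post-change observation `X k`, so the independent window
  -- starts at index `k + 1`. The extra `1` in the constant `C` pays for this observation.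
  have hterm : ∀ j : ℕ, ∫⁻ ω in A, (if ((k + 1 + j : ℕ) : ℕ∞) < T ω then (1 : ℝ≥0∞) else 0) ∂Q ≤
      min 1 (ENNReal.ofReal (Real.exp (s * τ - a * j))) * Q A := by
    intro j
    rw [min_mul_of_nonneg _ _ zero_le, one_mul]
    refine le_min ?_ ?_
    · calc _ ≤ ∫⁻ _ω in A, 1 ∂Q := by
            refine lintegral_mono fun ω => ?_
            split_ifs <;> simp
        _ = Q A := by simp
    · calc _ ≤ ∫⁻ ω in A, ENNReal.ofReal (Real.exp (s * τ)) *
            ∏ i ∈ Finset.Ico (k + 1) (k + 1 + j), ENNReal.ofReal (Real.exp (-s * z (X i ω))) ∂Q := by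
            refine lintegral_mono fun ω => ?_
            split_ifs with h
            swap
            · exact zero_le
            have hsum : ∑ i ∈ Finset.Ico (k + 1) (k + 1 + j), z (X i ω) ≤ τ := by
              by_contra hlt
              push Not at hlt
              rcases Nat.eq_zero_or_pos j with rfl | hj
              -- For `j = 0` the window is empty and its sum is `0`; here `0 ≤ τ` is needed.
              · simp at hlt
                linarith
              · exact absurd ((cusumTime_le_iff z X τ ω _).2
                  ⟨_, le_rfl, k + 1, by omega, hlt.le⟩) (not_le.2 h)
            rw [← ENNReal.ofReal_prod_of_nonneg fun i _ => (Real.exp_pos _).le, ← Real.exp_sum,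
              ← ENNReal.ofReal_mul (Real.exp_pos _).le, ← Real.exp_add, ← Finset.mul_sum,
              ENNReal.one_le_ofReal, Real.one_le_exp_iff]
            nlinarith
        _ = ENNReal.ofReal (Real.exp (s * τ - a * j)) * Q A := by
            rw [lintegral_const_mul _ (by fun_prop), hM.setLIntegral_prod (by simp) hA
              (f := fun x => ENNReal.ofReal (Real.exp (-s * z x))) (by fun_prop)]
            rw [Finset.prod_congr rfl fun i hi => by
              rw [hM.map_post (k := k) (i := i) (by have := (Finset.mem_Ico.1 hi).1; omega), hmgf]]
            rw [Finset.prod_const, Nat.card_Ico, Nat.add_sub_cancel_left,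
              ← ENNReal.ofReal_pow (Real.exp_pos _).le, ← Real.exp_nat_mul, mul_comm (Q A),
              ← mul_assoc, ← ENNReal.ofReal_mul (Real.exp_pos _).le, ← Real.exp_add]
            congr 4
            ring
  calc ∫⁻ ω in A, ((T ω : ℝ≥0∞) + 1 - ((k + 1 : ℕ) : ℝ≥0∞)) ∂Q
      ≤ ∫⁻ ω in A, (1 + ∑' j : ℕ, if ((k + 1 + j : ℕ) : ℕ∞) < T ω then (1 : ℝ≥0∞) else 0) ∂Q := by
        refine lintegral_mono fun ω => tsub_le_iff_right.2 ?_
        calc (T ω : ℝ≥0∞) + 1 ≤ _ := add_le_add (enat_le_add_tsum (T ω) (k + 1)) le_rfl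
          _ = _ := by ring
    _ = Q A + ∑' j : ℕ, ∫⁻ ω in A,
          (if ((k + 1 + j : ℕ) : ℕ∞) < T ω then (1 : ℝ≥0∞) else 0) ∂Q := by
        rw [lintegral_add_left measurable_const, lintegral_tsum fun j => (hmite j).aemeasurable]
        simp
    _ ≤ Q A + ∑' j : ℕ, min 1 (ENNReal.ofReal (Real.exp (s * τ - a * j))) * Q A :=
        add_le_add le_rfl (ENNReal.tsum_le_tsum hterm)
    _ = _ := by
        rw [ENNReal.tsum_mul_right]
        ring

/-! ### Lower bound for the delay of an arbitrary stopping time -/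

/-- A finite `t` lies in exactly those windows `(k, k + m]` with `t - m ≤ k < t`. -/
theorem tsum_indicator_window_le (t : ℕ∞) (m : ℕ) :
    ∑' k : ℕ, (if (k : ℕ∞) < t ∧ t ≤ (k + m : ℕ) then (1 : ℝ≥0∞) else 0) ≤ m := by
  induction t with
  | top => simp
  | coe n =>
    rw [tsum_eq_sum (s := Finset.Ico (n - m) n) fun k hk => by
      rw [if_neg]
      rintro ⟨h1, h2⟩
      have h1' : k < n := by exact_mod_cast h1
      have h2' : n ≤ k + m := by exact_mod_cast h2
      exact hk (Finset.mem_Ico.2 ⟨by omega, h1'⟩)]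
    calc _ ≤ ∑ _k ∈ Finset.Ico (n - m) n, (1 : ℝ≥0∞) := by
          refine Finset.sum_le_sum fun k _ => ?_
          split_ifs <;> simp
      _ ≤ m := by
          simp only [Finset.sum_const, Nat.card_Ico, nsmul_eq_mul, mul_one]
          exact_mod_cast (by omega : n - (n - m) ≤ m)

/-- A stopping time with a large mean time to false alarm has a change point after which it is
unlikely to stop within the next `m` observations. -/
theorem exists_window {ℱ : Filtration ℕ mΩ} {T : Ω → ℕ∞} [IsProbabilityMeasure (P ⊤)]
    (hT : IsStoppingTime ℱ T) {γ : ℝ} (hγ : 0 < γ) (harl : ENNReal.ofReal γ ≤ arl P T) {m : ℕ}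
    (hm : 0 < m) :
    ∃ k : ℕ, P ⊤ {ω | (k : ℕ∞) < T ω} ≠ 0 ∧
      P ⊤ {ω | (k : ℕ∞) < T ω ∧ T ω ≤ (k + m : ℕ)} ≤
        ENNReal.ofReal (2 * m / γ) * P ⊤ {ω | (k : ℕ∞) < T ω} := by
  -- Otherwise sum the reversed inequality over `k`. The tail probabilities add up to `arl P T ≥ γ`,
  -- giving at least `2 * m`, while the expected number of windows containing `T` is at most `m`.
  by_contra! hcon
  have hmeas : ∀ k : ℕ, MeasurableSet {ω | (k : ℕ∞) < T ω ∧ T ω ≤ (k + m : ℕ)} := fun k =>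
    (ℱ.le _ _ (measurableSet_lt_of_isStoppingTime hT k)).inter (ℱ.le _ _ (hT (k + m)))
  have hle : ∀ k : ℕ, ENNReal.ofReal (2 * m / γ) * P ⊤ {ω | (k : ℕ∞) < T ω} ≤
      P ⊤ {ω | (k : ℕ∞) < T ω ∧ T ω ≤ (k + m : ℕ)} := fun k => by
    by_cases h : P ⊤ {ω | (k : ℕ∞) < T ω} = 0
    · simp [h]
    · exact (hcon k h).le
  have h1 : ENNReal.ofReal (2 * m) ≤ m := by
    calc ENNReal.ofReal (2 * m) = ENNReal.ofReal (2 * m / γ) * ENNReal.ofReal γ := by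
          rw [← ENNReal.ofReal_mul (by positivity)]
          congr 1
          field_simp
      _ ≤ ENNReal.ofReal (2 * m / γ) * arl P T := by gcongr
      _ = ∑' k : ℕ, ENNReal.ofReal (2 * m / γ) * P ⊤ {ω | (k : ℕ∞) < T ω} := by
          rw [arl_eq_tsum hT, ENNReal.tsum_mul_left]
      _ ≤ ∑' k : ℕ, P ⊤ {ω | (k : ℕ∞) < T ω ∧ T ω ≤ (k + m : ℕ)} := ENNReal.tsum_le_tsum hle
      _ = ∫⁻ ω, ∑' k : ℕ, (if (k : ℕ∞) < T ω ∧ T ω ≤ (k + m : ℕ) then (1 : ℝ≥0∞) else 0)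
            ∂(P ⊤) := by
          rw [lintegral_tsum fun k => (Measurable.ite (hmeas k) measurable_const
            measurable_const).aemeasurable]
          refine tsum_congr fun k => ?_
          rw [← lintegral_indicator_one (hmeas k)]
          refine lintegral_congr fun ω => ?_
          simp [Set.indicator_apply]
      _ ≤ ∫⁻ _ω, m ∂(P ⊤) := lintegral_mono fun ω => tsum_indicator_window_le _ _
      _ = m := by simp
  rw [← ENNReal.ofReal_natCast, ENNReal.ofReal_le_ofReal_iff (by positivity)] at h1
  have : (0 : ℝ) < m := by exact_mod_cast hm
  linarith

/-- A change of measure over the window `k, …, k + m - 1` together with a Chernoff bound. -/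
theorem IsChangePointModel.apply_window_le (hM : IsChangePointModel P X P₀ P₁)
    {z : E → ℝ} (hz : Measurable z)
    (hP : P₁ = P₀.withDensity fun x => ENNReal.ofReal (Real.exp (z x)))
    {s b : ℝ} (hs : 0 ≤ s)
    (hmgf : ∫⁻ x, ENNReal.ofReal (Real.exp (s * z x)) ∂P₁ = ENNReal.ofReal (Real.exp b))
    {T : Ω → ℕ∞} (hT : IsStoppingTime (obsFiltration X hM.measurable) T) (k m : ℕ) (c : ℝ) :
    P (k + 1 : ℕ) {ω | (k : ℕ∞) < T ω ∧ T ω ≤ (k + m : ℕ)} ≤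
      ENNReal.ofReal (Real.exp c) * P ⊤ {ω | (k : ℕ∞) < T ω ∧ T ω ≤ (k + m : ℕ)} +
        ENNReal.ofReal (Real.exp (m * b - s * c)) * P (k + 1 : ℕ) {ω | (k : ℕ∞) < T ω} := by
  have hmX := hM.measurable
  set ℱ := obsFiltration X hM.measurable
  set A := {ω | (k : ℕ∞) < T ω} with hAdef
  set B := {ω | (k : ℕ∞) < T ω ∧ T ω ≤ (k + m : ℕ)} with hBdef
  set Q := P ((k + 1 : ℕ) : ℕ∞) with hQ
  have hA : MeasurableSet[ℱ k] A := measurableSet_lt_of_isStoppingTime hT k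
  have hB : MeasurableSet[ℱ (k + m)] B :=
    (ℱ.mono (Nat.le_add_right k m) _ hA).inter (hT (k + m))
  -- Truncation: on `G` the likelihood ratio of the window is at most `exp c`, which bounds the
  -- change of measure. Off `G` the exponential moment at `s` takes over, with the past event `A`
  -- split off by independence.
  set G := {ω | ∑ i ∈ Finset.Ico k (k + m), z (X i ω) ≤ c} with hGdef
  have hG : MeasurableSet[ℱ (k + m)] G := by
    have hsum : Measurable[ℱ (k + m)] fun ω => ∑ i ∈ Finset.Ico k (k + m), z (X i ω) :=
      Finset.measurable_sum _ fun i hi =>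
        hz.comp (measurable_obsFiltration X hM.measurable (Finset.mem_Ico.1 hi).2)
    exact hsum measurableSet_Iic
  have hprod : ∀ (r : ℝ) ω, ∏ i ∈ Finset.Ico k (k + m), ENNReal.ofReal (Real.exp (r * z (X i ω))) =
      ENNReal.ofReal (Real.exp (r * ∑ i ∈ Finset.Ico k (k + m), z (X i ω))) := fun r ω => by
    rw [← ENNReal.ofReal_prod_of_nonneg fun i _ => (Real.exp_pos _).le, ← Real.exp_sum,
      ← Finset.mul_sum]
  calc Q B ≤ Q (B ∩ G) + Q (B \ G) := measure_le_inter_add_sdiff _ _ _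
    _ ≤ _ := add_le_add ?_ ?_
  · rw [hM.apply_eq_setLIntegral (by fun_prop) hP (hB.inter hG)]
    calc _ ≤ ∫⁻ _ω in B ∩ G, ENNReal.ofReal (Real.exp c) ∂(P ⊤) := by
          refine setLIntegral_mono' (ℱ.le _ _ (hB.inter hG)) fun ω hω => ?_
          have := hprod 1 ω
          simp only [one_mul] at this
          rw [this]
          exact ENNReal.ofReal_le_ofReal (Real.exp_le_exp.2 hω.2)
      _ ≤ _ := by
          rw [setLIntegral_const]
          gcongr
          exact Set.inter_subset_left
  · have hBG : MeasurableSet (B \ G) := ℱ.le _ _ (hB.diff hG)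
    calc Q (B \ G) = ∫⁻ _ω in B \ G, 1 ∂Q := by simp
      _ ≤ ∫⁻ ω in B \ G, ENNReal.ofReal (Real.exp (-(s * c))) *
            ∏ i ∈ Finset.Ico k (k + m), ENNReal.ofReal (Real.exp (s * z (X i ω))) ∂Q := by
          refine setLIntegral_mono' hBG fun ω hω => ?_
          rw [hprod, ← ENNReal.ofReal_mul (Real.exp_pos _).le, ← Real.exp_add,
            ENNReal.one_le_ofReal, Real.one_le_exp_iff]
          have : c < ∑ i ∈ Finset.Ico k (k + m), z (X i ω) := not_le.1 hω.2
          nlinarith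
      _ ≤ ∫⁻ ω in A, ENNReal.ofReal (Real.exp (-(s * c))) *
            ∏ i ∈ Finset.Ico k (k + m), ENNReal.ofReal (Real.exp (s * z (X i ω))) ∂Q :=
          lintegral_mono_set fun ω hω => hω.1.1
      _ = _ := by
          rw [lintegral_const_mul _ (by fun_prop), hM.setLIntegral_prod (by simp) hA
            (f := fun x => ENNReal.ofReal (Real.exp (s * z x))) (by fun_prop)]
          rw [Finset.prod_congr rfl fun i hi => by
            rw [hM.map_post (k := k) (i := i) (Finset.mem_Ico.1 hi).1, hmgf]]
          rw [Finset.prod_const, Nat.card_Ico, Nat.add_sub_cancel_left,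
            ← ENNReal.ofReal_pow (Real.exp_pos _).le, ← Real.exp_nat_mul, mul_comm (Q A),
            ← mul_assoc, ← ENNReal.ofReal_mul (Real.exp_pos _).le, ← Real.exp_add]
          congr 3
          ring

/-- For the window found under `P ⊤`, the change of measure bounds the conditional probability of
stopping inside it after a change at `k + 1`. If `T` passes the window, the delay `T - (k + 1)` is
at least `m`. -/
theorem IsChangePointModel.le_cadd (hM : IsChangePointModel P X P₀ P₁)
    {z : E → ℝ} (hz : Measurable z)
    (hP : P₁ = P₀.withDensity fun x => ENNReal.ofReal (Real.exp (z x)))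
    {s b : ℝ} (hs : 0 ≤ s)
    (hmgf : ∫⁻ x, ENNReal.ofReal (Real.exp (s * z x)) ∂P₁ = ENNReal.ofReal (Real.exp b))
    {T : Ω → ℕ∞} (hT : IsStoppingTime (obsFiltration X hM.measurable) T) {γ : ℝ} (hγ : 0 < γ)
    (harl : ENNReal.ofReal γ ≤ arl P T) (m : ℕ) (c : ℝ) :
    m * (1 - ENNReal.ofReal (Real.exp c * (2 * m / γ) + Real.exp (m * b - s * c))) ≤ cadd P T := by
  rcases Nat.eq_zero_or_pos m with rfl | hm
  · simp
  have := hM.isProbabilityMeasure ⊤ le_top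
  obtain ⟨k, hk0, hk⟩ := exists_window hT hγ harl hm
  have := hM.isProbabilityMeasure (k + 1 : ℕ) (by simp)
  have hwin := hM.apply_window_le hz hP hs hmgf hT k m c
  set ℱ := obsFiltration X hM.measurable
  have hA : MeasurableSet[ℱ k] {ω | (k : ℕ∞) < T ω} := measurableSet_lt_of_isStoppingTime hT k
  have hAtop := hM.apply_eq_top (by fun_prop) hP hA
  rw [← hAtop] at hk0 hk
  set A := {ω | (k : ℕ∞) < T ω} with hAdef
  set B := {ω | (k : ℕ∞) < T ω ∧ T ω ≤ (k + m : ℕ)} with hBdef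
  set Q := P ((k + 1 : ℕ) : ℕ∞) with hQ
  set q := ENNReal.ofReal (Real.exp c * (2 * m / γ) + Real.exp (m * b - s * c)) with hq
  have hA' : MeasurableSet A := ℱ.le _ _ hA
  have hB' : MeasurableSet B := hA'.inter (ℱ.le _ _ (hT (k + m)))
  have hQB : Q B ≤ q * Q A := by
    rw [hq, ENNReal.ofReal_add (by positivity) (Real.exp_pos _).le,
      ENNReal.ofReal_mul (Real.exp_pos _).le, add_mul]
    refine hwin.trans (add_le_add ?_ le_rfl)
    rw [mul_assoc]
    gcongr
  have hAset : {ω | ((k + 1 : ℕ) : ℕ∞) ≤ T ω} = A := by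
    ext ω
    simp only [Set.mem_ofPred_eq, hAdef]
    push_cast
    exact ENat.add_one_le_iff (ENat.natCast_ne_top k)
  have hcadd : (Q A)⁻¹ * ∫⁻ ω in A, ((T ω : ℝ≥0∞) - ((k + 1 : ℕ) : ℝ≥0∞)) ∂Q ≤ cadd P T := by
    refine le_trans (le_of_eq ?_) (le_iSup₂ (f := fun (ν : ℕ) (_ : 1 ≤ ν) =>
      ∫⁻ ω, ((T ω : ℝ≥0∞) - (ν : ℝ≥0∞)) ∂(ProbabilityTheory.cond (P ν) {ω | (ν : ℕ∞) ≤ T ω}))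
      (k + 1) (by omega))
    rw [hAset, ProbabilityTheory.cond, lintegral_smul_measure, smul_eq_mul]
  refine le_trans ?_ hcadd
  calc (m : ℝ≥0∞) * (1 - q) = (Q A)⁻¹ * (m * (Q A - q * Q A)) := by
        have : Q A - q * Q A = (1 - q) * Q A := by
          rw [ENNReal.sub_mul fun _ _ => measure_ne_top _ _, one_mul]
        rw [this, mul_comm (1 - q), mul_left_comm, ← mul_assoc (Q A)⁻¹,
          ENNReal.inv_mul_cancel hk0 (measure_ne_top _ _), one_mul]
    _ ≤ (Q A)⁻¹ * (m * Q (A \ B)) := by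
        gcongr
        exact (tsub_le_tsub_left hQB _).trans (le_measure_sdiff)
    _ = (Q A)⁻¹ * ∫⁻ _ω in A \ B, m ∂Q := by rw [setLIntegral_const]
    _ ≤ (Q A)⁻¹ * ∫⁻ ω in A \ B, ((T ω : ℝ≥0∞) - ((k + 1 : ℕ) : ℝ≥0∞)) ∂Q := by
        gcongr 1
        refine setLIntegral_mono' (hA'.diff hB') fun ω hω => ?_
        refine ENNReal.le_sub_of_add_le_right (ENNReal.natCast_ne_top _) ?_
        have h : ((k + m : ℕ) : ℕ∞) < T ω := not_le.1 fun h => hω.2 ⟨hω.1, h⟩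
        have h' : ((m + (k + 1) : ℕ) : ℕ∞) ≤ T ω := by
          have := (ENat.add_one_le_iff (ENat.natCast_ne_top (k + m))).2 h
          convert this using 1
          push_cast
          ring
        exact_mod_cast ENat.toENNReal_mono h'
    _ ≤ _ := by
        gcongr 1
        exact lintegral_mono_set Set.sdiff_subset

end Detection

/-! ### Asymptotic equivalence -/

theorem tendsto_div_one_of_bounds {f : ℝ → ℝ≥0∞} {g : ℝ → ℝ} (hg : ∀ᶠ γ in atTop, 0 < g γ)
    (hu : ∀ r : ℝ, 1 < r → ∀ᶠ γ in atTop, f γ ≤ ENNReal.ofReal (r * g γ))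
    (hl : ∀ r : ℝ, 0 < r → r < 1 → ∀ᶠ γ in atTop, ENNReal.ofReal (r * g γ) ≤ f γ) :
    Tendsto (fun γ => f γ / ENNReal.ofReal (g γ)) atTop (𝓝 1) := by
  rw [tendsto_order]
  constructor
  · intro a ha
    obtain ⟨r, hr0, har, hr1⟩ : ∃ r : ℝ, 0 < r ∧ a < ENNReal.ofReal r ∧ r < 1 := by
      obtain ⟨b, hab, hb1⟩ := exists_between ha
      have hb : b ≠ ⊤ := hb1.ne_top
      refine ⟨b.toReal, ENNReal.toReal_pos (ne_bot_of_gt hab) hb, by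
        rwa [ENNReal.ofReal_toReal hb], ?_⟩
      simpa using (ENNReal.toReal_lt_toReal hb ENNReal.one_ne_top).2 hb1
    filter_upwards [hg, hl r hr0 hr1] with γ h1 h2
    refine har.trans_le ?_
    rw [ENNReal.le_div_iff_mul_le (Or.inl (by simpa using h1)) (Or.inl ENNReal.ofReal_ne_top),
      ← ENNReal.ofReal_mul hr0.le]
    exact h2
  · intro a ha
    obtain ⟨r, har, hr1⟩ : ∃ r : ℝ, ENNReal.ofReal r < a ∧ 1 < r := by
      obtain ⟨b, h1b, hba⟩ := exists_between ha
      have hb : b ≠ ⊤ := hba.ne_top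
      refine ⟨b.toReal, by rwa [ENNReal.ofReal_toReal hb], ?_⟩
      simpa using (ENNReal.toReal_lt_toReal ENNReal.one_ne_top hb).2 h1b
    filter_upwards [hg, hu r hr1] with γ h1 h2
    refine lt_of_le_of_lt ?_ har
    refine ENNReal.div_le_of_le_mul ?_
    rw [← ENNReal.ofReal_mul (by linarith)]
    exact h2

theorem asympEquiv_of_tendsto_div {f₁ f₂ : ℝ → ℝ≥0∞} {g : ℝ → ℝ}
    (hg : ∀ᶠ γ in atTop, 0 < g γ)
    (h₁ : Tendsto (fun γ => f₁ γ / ENNReal.ofReal (g γ)) atTop (𝓝 1))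
    (h₂ : Tendsto (fun γ => f₂ γ / ENNReal.ofReal (g γ)) atTop (𝓝 1)) : AsympEquiv f₁ f₂ := by
  have h := ENNReal.Tendsto.div h₁ (Or.inl one_ne_zero) h₂ (Or.inl ENNReal.one_ne_top)
  rw [div_one] at h
  refine h.congr' ?_
  filter_upwards [hg] with γ hγ
  have h0 : (ENNReal.ofReal (g γ))⁻¹ ≠ 0 := by simp
  have ht : (ENNReal.ofReal (g γ))⁻¹ ≠ ⊤ := by simpa using hγ
  simp only [div_eq_mul_inv (f₁ γ) (ENNReal.ofReal _), div_eq_mul_inv (f₂ γ) (ENNReal.ofReal _)]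
  exact ENNReal.mul_div_mul_right _ _ h0 ht

section Detection

variable {Ω E : Type*} {mΩ : MeasurableSpace Ω} {mE : MeasurableSpace E}
  {P : ℕ∞ → Measure Ω} {X : ℕ → Ω → E} {P₀ P₁ : Measure E}

/-- First-order upper bound for Lorden's delay of the CUSUM rule with threshold at most `log γ`. -/
theorem IsChangePointModel.eventually_wadd_cusumTime_le (hM : IsChangePointModel P X P₀ P₁)
    {z : E → ℝ} (hz : Measurable z) {D : ℝ} (hD : 0 < D)
    (hmgf : ∀ s : ℝ, ∫⁻ x, ENNReal.ofReal (Real.exp (s * z x)) ∂P₁ =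
      ENNReal.ofReal (Real.exp (D * (s + s ^ 2))))
    {τ : ℝ → ℝ} (hτ : ∀ᶠ γ in atTop, 0 < τ γ ∧ τ γ ≤ Real.log γ) {r : ℝ} (hr : 1 < r) :
    ∀ᶠ γ in atTop, wadd P (obsFiltration X hM.measurable) (cusumTime z X (τ γ)) ≤
      ENNReal.ofReal (r * (Real.log γ / D)) := by
  -- With this `s`, `(1 - s)⁻¹ = 2 r / (r + 1) < r`. The leading term `s τ / a` equals `(1 - s)⁻¹ τ
  -- / D`, and the remaining slack absorbs the constant `C` for large `γ`.
  set s := (r - 1) / (2 * r) with hsdef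
  have hs : 0 < s := div_pos (by linarith) (by linarith)
  have hs1 : 1 - s = (r + 1) / (2 * r) := by
    rw [hsdef]
    field_simp
    ring
  have hs1' : 0 < 1 - s := by rw [hs1]; positivity
  set a := D * (s * (1 - s)) with hadef
  have ha : 0 < a := by positivity
  have hmgf' : ∫⁻ x, ENNReal.ofReal (Real.exp (-s * z x)) ∂P₁ =
      ENNReal.ofReal (Real.exp (-a)) := by
    rw [hmgf, hadef]
    congr 2
    ring
  set C := 2 + (1 - Real.exp (-a))⁻¹
  have hlarge : ∀ᶠ γ in atTop, C ≤ (r - (1 - s)⁻¹) / D * Real.log γ := by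
    refine Tendsto.eventually_ge_atTop (Real.tendsto_log_atTop.const_mul_atTop ?_) C
    refine div_pos ?_ hD
    rw [hs1, inv_div, sub_pos, div_lt_iff₀ (by linarith)]
    nlinarith
  filter_upwards [hτ, hlarge] with γ h1 h2
  refine (hM.wadd_cusumTime_le hz hs ha h1.1.le hmgf').trans (ENNReal.ofReal_le_ofReal ?_)
  have h3 : s * τ γ / a ≤ (1 - s)⁻¹ / D * Real.log γ := by
    have : s * τ γ / a = (1 - s)⁻¹ / D * τ γ := by
      rw [hadef]
      field_simp
    rw [this]
    gcongr
    exact h1.2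
  calc 1 + (s * τ γ / a + 1 + (1 - Real.exp (-a))⁻¹) = s * τ γ / a + C := by ring
    _ ≤ (1 - s)⁻¹ / D * Real.log γ + (r - (1 - s)⁻¹) / D * Real.log γ := add_le_add h3 h2
    _ = r * (Real.log γ / D) := by ring

/-- First-order lower bound for Pollak's delay of all stopping times with mean time to false alarm
at least `γ`. -/
theorem IsChangePointModel.eventually_le_cadd (hM : IsChangePointModel P X P₀ P₁)
    {z : E → ℝ} (hz : Measurable z)
    (hP : P₁ = P₀.withDensity fun x => ENNReal.ofReal (Real.exp (z x))) {D : ℝ} (hD : 0 < D)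
    (hmgf : ∀ s : ℝ, ∫⁻ x, ENNReal.ofReal (Real.exp (s * z x)) ∂P₁ =
      ENNReal.ofReal (Real.exp (D * (s + s ^ 2)))) {r : ℝ} (hr0 : 0 < r) (hr : r < 1) :
    ∀ᶠ γ in atTop, ∀ T : Ω → ℕ∞, IsStoppingTime (obsFiltration X hM.measurable) T →
      ENNReal.ofReal γ ≤ arl P T → ENNReal.ofReal (r * (Real.log γ / D)) ≤ cadd P T := by
  -- Three factors `1 - ε` will be lost: two in the window length, one in the probability of not
  -- stopping. This `ε` keeps their product above `r`.
  set ε := (1 - r) / 4 with hεdef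
  have hε : 0 < ε := by linarith
  have hε1 : ε < 1 := by linarith
  have hcube : r < (1 - ε) ^ 3 := by
    have : r = 1 - 4 * ε := by linarith
    rw [this]
    nlinarith [mul_pos hε hε, mul_pos (mul_pos hε hε) (sub_pos.2 hε1)]
  have hδ : 0 < 1 - ε := by linarith
  have hT1 : Tendsto (fun L : ℝ => 2 * ((1 - ε) ^ 2 / D) * (L * Real.exp (-(ε * L)))) atTop
      (𝓝 0) := by
    have := Real.tendsto_pow_mul_exp_neg_atTop_nhds_zero 1
    have h2 := this.comp (tendsto_id.const_mul_atTop hε)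
    have h3 := h2.const_mul (2 * ((1 - ε) ^ 2 / D) / ε)
    rw [mul_zero] at h3
    refine h3.congr fun L => ?_
    simp only [Function.comp_apply, id_eq, pow_one]
    field_simp
  have hT2 : Tendsto (fun L : ℝ => Real.exp (-(ε ^ 3 * (1 - ε) * L))) atTop (𝓝 0) :=
    Real.tendsto_exp_neg_atTop_nhds_zero.comp
      (tendsto_id.const_mul_atTop (by positivity : 0 < ε ^ 3 * (1 - ε)))
  have hsum := (hT1.add hT2).comp Real.tendsto_log_atTop
  rw [add_zero] at hsum
  have hev1 := hsum.eventually (gt_mem_nhds hε)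
  have hev2 : ∀ᶠ γ in atTop, (1 - ε) ≤ ((1 - ε) ^ 3 - r) / D * Real.log γ :=
    Tendsto.eventually_ge_atTop
      (Real.tendsto_log_atTop.const_mul_atTop (div_pos (by linarith) hD)) _
  filter_upwards [hev1, hev2, eventually_gt_atTop 1] with γ h1 h2 hγ T hT harl
  have hγ0 : 0 < γ := by linarith
  set L := Real.log γ with hL
  have hL0 : 0 < L := Real.log_pos hγ
  have hγL : γ = Real.exp L := (Real.exp_log hγ0).symm
  -- With `c = (1 - ε) L`, `exp c` is `γ` times `exp (-(ε L))`, which beats the linear factor `m`.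
  -- The mean drift `m D` is at most `(1 - ε)² L < c`, and the Chernoff exponent at `s = ε` is at
  -- most `-ε³ (1 - ε) L`.
  set m := ⌊(1 - ε) ^ 2 * L / D⌋₊
  have hm1 : (m : ℝ) ≤ (1 - ε) ^ 2 * L / D := Nat.floor_le (by positivity)
  have hm2 : (1 - ε) ^ 2 * L / D - 1 < m := Nat.sub_one_lt_floor _
  refine le_trans ?_ (hM.le_cadd hz hP hε.le (hmgf ε) hT hγ0 harl m ((1 - ε) * L))
  have hq : Real.exp ((1 - ε) * L) * (2 * m / γ) +
      Real.exp (m * (D * (ε + ε ^ 2)) - ε * ((1 - ε) * L)) ≤ ε := by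
    refine le_trans (add_le_add ?_ (Real.exp_le_exp.2 ?_)) h1.le
    · have : Real.exp ((1 - ε) * L) * (2 * m / γ) = 2 * m * Real.exp (-(ε * L)) := by
        rw [hγL, mul_div_assoc', div_eq_iff (Real.exp_pos _).ne', mul_assoc, ← Real.exp_add]
        rw [show -(ε * L) + L = (1 - ε) * L by ring]
        ring
      rw [this]
      calc 2 * m * Real.exp (-(ε * L)) ≤ 2 * ((1 - ε) ^ 2 * L / D) * Real.exp (-(ε * L)) := by
            gcongr
        _ = _ := by ring
    · have h3 : m * (D * (ε + ε ^ 2)) ≤ (1 - ε) ^ 2 * L / D * (D * (ε + ε ^ 2)) := by gcongr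
      have h4 : (1 - ε) ^ 2 * L / D * (D * (ε + ε ^ 2)) = (1 - ε) ^ 2 * L * (ε + ε ^ 2) := by
        field_simp
      calc _ ≤ (1 - ε) ^ 2 * L * (ε + ε ^ 2) - ε * ((1 - ε) * L) := by linarith
        _ = _ := by ring
  calc ENNReal.ofReal (r * (L / D)) ≤ ENNReal.ofReal (m * (1 - ε)) := by
        refine ENNReal.ofReal_le_ofReal ?_
        have h5 : ((1 - ε) ^ 2 * L / D - 1) * (1 - ε) ≤ m * (1 - ε) := by gcongr
        have h6 : ((1 - ε) ^ 2 * L / D - 1) * (1 - ε) =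
            ((1 - ε) ^ 3 - r) / D * L + r * (L / D) - (1 - ε) := by ring
        linarith
    _ = m * (1 - ENNReal.ofReal ε) := by
        rw [ENNReal.ofReal_mul (by positivity), ENNReal.ofReal_natCast,
          ENNReal.ofReal_sub _ hε.le, ENNReal.ofReal_one]
    _ ≤ _ := by gcongr

/-- First-order asymptotics and optimality of the CUSUM rule for Lorden's and Pollak's problem. -/
theorem IsChangePointModel.asympEquiv_cusumTime (hM : IsChangePointModel P X P₀ P₁)
    {z : E → ℝ} (hz : Measurable z)
    (hP : P₁ = P₀.withDensity fun x => ENNReal.ofReal (Real.exp (z x))) {D : ℝ} (hD : 0 < D)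
    (hmgf : ∀ s : ℝ, ∫⁻ x, ENNReal.ofReal (Real.exp (s * z x)) ∂P₁ =
      ENNReal.ofReal (Real.exp (D * (s + s ^ 2))))
    {τ : ℝ → ℝ} (hτ : ∀ᶠ γ in atTop, 0 < τ γ ∧ τ γ ≤ Real.log γ ∧
      ENNReal.ofReal γ ≤ arl P (cusumTime z X (τ γ))) :
    AsympEquiv
      (fun γ => wadd P (obsFiltration X hM.measurable) (cusumTime z X (τ γ)))
      (fun γ => cadd P (cusumTime z X (τ γ))) ∧
    AsympEquiv
      (fun γ => cadd P (cusumTime z X (τ γ)))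
      (fun γ => ENNReal.ofReal (Real.log γ) / ENNReal.ofReal D) ∧
    AsympEquiv
      (fun γ => wadd P (obsFiltration X hM.measurable) (cusumTime z X (τ γ)))
      (fun γ => ENNReal.ofReal (Real.log γ) / ENNReal.ofReal D) ∧
    AsympEquiv
      (fun γ => wadd P (obsFiltration X hM.measurable) (cusumTime z X (τ γ)))
      (optimalDelay P (obsFiltration X hM.measurable)
        (wadd P (obsFiltration X hM.measurable))) ∧
    AsympEquiv
      (fun γ => cadd P (cusumTime z X (τ γ)))
      (optimalDelay P (obsFiltration X hM.measurable) (cadd P)) := by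
  have hg : ∀ᶠ γ in atTop, 0 < Real.log γ / D := by
    filter_upwards [eventually_gt_atTop 1] with γ hγ
    exact div_pos (Real.log_pos hγ) hD
  have hST := fun γ => isStoppingTime_cusumTime hz hM.measurable (τ γ)
  have hup := fun r (hr : (1 : ℝ) < r) => hM.eventually_wadd_cusumTime_le hz hD hmgf
    (hτ.mono fun γ h => ⟨h.1, h.2.1⟩) hr
  have hlow := fun r (hr0 : (0 : ℝ) < r) (hr : r < 1) =>
    hM.eventually_le_cadd hz hP hD hmgf hr0 hr
  -- In all four limits the upper bound is that of CUSUM's `wadd` and the lower bound is that of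
  -- `cadd` for arbitrary rules; `cadd_le_wadd` bridges the two criteria.
  have hW := tendsto_div_one_of_bounds hg hup fun r hr0 hr => by
    filter_upwards [hlow r hr0 hr, hτ] with γ h1 h2
    exact (h1 _ (hST γ) h2.2.2).trans (hM.cadd_le_wadd (hST γ))
  have hC := tendsto_div_one_of_bounds (f := fun γ => cadd P (cusumTime z X (τ γ))) hg
    (fun r hr => by
      filter_upwards [hup r hr] with γ h1
      exact (hM.cadd_le_wadd (hST γ)).trans h1)
    fun r hr0 hr => by
      filter_upwards [hlow r hr0 hr, hτ] with γ h1 h2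
      exact h1 _ (hST γ) h2.2.2
  have hOW := tendsto_div_one_of_bounds (f := optimalDelay P (obsFiltration X hM.measurable)
      (wadd P (obsFiltration X hM.measurable))) hg
    (fun r hr => by
      filter_upwards [hup r hr, hτ] with γ h1 h2
      exact (iInf₂_le _ ⟨hST γ, h2.2.2⟩).trans h1)
    fun r hr0 hr => by
      filter_upwards [hlow r hr0 hr] with γ h1
      exact le_iInf₂ fun T hT => (h1 T hT.1 hT.2).trans (hM.cadd_le_wadd hT.1)
  have hOC := tendsto_div_one_of_bounds (f := optimalDelay P (obsFiltration X hM.measurable)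
      (cadd P)) hg
    (fun r hr => by
      filter_upwards [hup r hr, hτ] with γ h1 h2
      exact (iInf₂_le _ ⟨hST γ, h2.2.2⟩).trans ((hM.cadd_le_wadd (hST γ)).trans h1))
    fun r hr0 hr => by
      filter_upwards [hlow r hr0 hr] with γ h1
      exact le_iInf₂ fun T hT => h1 T hT.1 hT.2
  have hL : Tendsto (fun γ => ENNReal.ofReal (Real.log γ) / ENNReal.ofReal D /
      ENNReal.ofReal (Real.log γ / D)) atTop (𝓝 1) := by
    refine tendsto_const_nhds.congr' ?_
    filter_upwards [hg] with γ h
    rw [← ENNReal.ofReal_div_of_pos hD, ENNReal.div_self (by simpa using h) ENNReal.ofReal_ne_top]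
  exact ⟨asympEquiv_of_tendsto_div hg hW hC, asympEquiv_of_tendsto_div hg hC hL,
    asympEquiv_of_tendsto_div hg hW hL, asympEquiv_of_tendsto_div hg hW hOW,
    asympEquiv_of_tendsto_div hg hC hOC⟩

end Detection

open InnerProductSpace

/-! ### Translates of Gaussian measures -/

theorem gaussianReal_eq_withDensity (a : ℝ) :
    gaussianReal a 1 =
      (gaussianReal 0 1).withDensity fun x => ENNReal.ofReal (Real.exp (a * x - a ^ 2 / 2)) := by
  rw [gaussianReal_of_var_ne_zero _ one_ne_zero, gaussianReal_of_var_ne_zero _ one_ne_zero,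
    ← withDensity_mul _ (measurable_gaussianPDF _ _) (by fun_prop)]
  congr 1
  ext x
  rw [Pi.mul_apply, gaussianPDF, gaussianPDF, ← ENNReal.ofReal_mul (gaussianPDFReal_nonneg _ _ _),
    gaussianPDFReal, gaussianPDFReal, mul_assoc _ (Real.exp (-(x - 0) ^ 2 / _)), ← Real.exp_add]
  congr 3
  simp only [NNReal.coe_one]
  ring

/-- The standard Gaussian is a product measure and translation acts coordinatewise, so the
one-dimensional densities multiply. -/
theorem map_add_stdGaussian {d : ℕ} (h : EuclideanSpace ℝ (Fin d)) :
    (stdGaussian (EuclideanSpace ℝ (Fin d))).map (fun x => x + h) =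
      (stdGaussian (EuclideanSpace ℝ (Fin d))).withDensity fun x =>
        ENNReal.ofReal (Real.exp (⟪h, x⟫_ℝ - ‖h‖ ^ 2 / 2)) := by
  have hto : Measurable (WithLp.toLp 2 : (Fin d → ℝ) → EuclideanSpace ℝ (Fin d)) := by fun_prop
  rw [← map_pi_eq_stdGaussian, ← map_withDensity_comp _ hto (by fun_prop),
    Measure.map_map (by fun_prop) hto]
  have h1 : ((fun x : EuclideanSpace ℝ (Fin d) => x + h) ∘ WithLp.toLp 2) =
      WithLp.toLp 2 ∘ fun (x : Fin d → ℝ) i => x i + h i := by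
    ext x i
    simp
  rw [h1, ← Measure.map_map hto (by fun_prop)]
  congr 1
  have h2 : (Measure.pi fun _ : Fin d => gaussianReal 0 1).map (fun x i => x i + h i) =
      Measure.pi fun i => gaussianReal (h i) 1 := by
    rw [Measure.pi_map_pi (f := fun i (y : ℝ) => y + h i) fun i => by fun_prop]
    simp_rw [gaussianReal_map_add_const, zero_add]
  rw [h2]
  have hsf : ∀ i, SigmaFinite ((gaussianReal 0 1).withDensity fun x =>
      ENNReal.ofReal (Real.exp (h i * x - h i ^ 2 / 2))) := fun i => by
    rw [← gaussianReal_eq_withDensity]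
    infer_instance
  have h3 : (fun i => gaussianReal (h i) 1) = fun i => (gaussianReal 0 1).withDensity fun x =>
      ENNReal.ofReal (Real.exp (h i * x - h i ^ 2 / 2)) :=
    funext fun i => gaussianReal_eq_withDensity (h i)
  rw [h3, pi_withDensity (fun _ : Fin d => gaussianReal 0 1)
    (fun i x => ENNReal.ofReal (Real.exp (h i * x - h i ^ 2 / 2))) (fun i => by fun_prop)]
  congr 1
  ext x
  rw [← ENNReal.ofReal_prod_of_nonneg fun i _ => (Real.exp_pos _).le, ← Real.exp_sum]
  simp only [Function.comp_apply, EuclideanSpace.real_norm_sq_eq, PiLp.inner_apply]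
  rw [Finset.sum_sub_distrib, Finset.sum_div]
  simp [mul_comm]

open scoped MatrixOrder in
/-- The Cameron–Martin formula. -/
theorem multivariateGaussian_add {d : ℕ} (θ v : EuclideanSpace ℝ (Fin d))
    {S : Matrix (Fin d) (Fin d) ℝ} (hS : S.PosSemidef) :
    multivariateGaussian (θ + Matrix.toEuclideanCLM (𝕜 := ℝ) S v) S =
      (multivariateGaussian θ S).withDensity fun x => ENNReal.ofReal
        (Real.exp (⟪v, x - θ⟫_ℝ - ⟪v, Matrix.toEuclideanCLM (𝕜 := ℝ) S v⟫_ℝ / 2)) := by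
  -- With `R` the operator of the square root of `S`, the shift by `S v = R (R v)` is the image
  -- under `R` of the shift by `R v` of the standard Gaussian.
  have hsq : Matrix.toEuclideanCLM (𝕜 := ℝ) S v =
      Matrix.toEuclideanCLM (𝕜 := ℝ) (CFC.sqrt S)
        (Matrix.toEuclideanCLM (𝕜 := ℝ) (CFC.sqrt S) v) := by
    rw [← ContinuousLinearMap.comp_apply, ← ContinuousLinearMap.mul_def, ← map_mul,
      CFC.sqrt_mul_sqrt_self _ hS.nonneg]
  have hadj : ∀ x y : EuclideanSpace ℝ (Fin d),
      ⟪Matrix.toEuclideanCLM (𝕜 := ℝ) (CFC.sqrt S) x, y⟫_ℝ =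
        ⟪x, Matrix.toEuclideanCLM (𝕜 := ℝ) (CFC.sqrt S) y⟫_ℝ := by
    have h := ((CFC.sqrt_nonneg S).isSelfAdjoint.map (Matrix.toEuclideanCLM (𝕜 := ℝ))).adjoint_eq
    intro x y
    conv_lhs => rw [← h]
    exact ContinuousLinearMap.adjoint_inner_left _ _ _
  rw [hsq]
  set R := Matrix.toEuclideanCLM (n := Fin d) (𝕜 := ℝ) (CFC.sqrt S)
  have hf : Measurable fun x => θ + R x := by fun_prop
  rw [multivariateGaussian, multivariateGaussian, ← map_withDensity_comp _ hf (by fun_prop)]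
  have h1 : (fun x => θ + R (R v) + R x) = (fun x => θ + R x) ∘ fun x => x + R v := by
    ext1 x
    simp only [Function.comp_apply, map_add]
    abel
  change Measure.map (fun x => θ + R (R v) + R x) _ = _
  rw [h1, ← Measure.map_map hf (by fun_prop), map_add_stdGaussian]
  congr 2
  ext x
  simp only [Function.comp_apply, add_sub_cancel_left]
  rw [← hadj v x, ← hadj v (R v), real_inner_self_eq_norm_sq]

/-- The Cameron–Martin density integrates to `1` because the translated Gaussian has total mass `1`;
no explicit integral is computed. -/
theorem lintegral_exp_multivariateGaussian {d : ℕ} (θ v : EuclideanSpace ℝ (Fin d))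
    {S : Matrix (Fin d) (Fin d) ℝ} (hS : S.PosSemidef) (c : ℝ) :
    ∫⁻ x, ENNReal.ofReal (Real.exp (⟪v, x - θ⟫_ℝ + c)) ∂(multivariateGaussian θ S) =
      ENNReal.ofReal (Real.exp (⟪v, Matrix.toEuclideanCLM (𝕜 := ℝ) S v⟫_ℝ / 2 + c)) := by
  have h : (multivariateGaussian (θ + Matrix.toEuclideanCLM (𝕜 := ℝ) S v) S) Set.univ = 1 :=
    measure_univ
  rw [multivariateGaussian_add θ v hS, withDensity_apply _ .univ, setLIntegral_univ] at h
  calc _ = ∫⁻ x, ENNReal.ofReal (Real.exp (⟪v, Matrix.toEuclideanCLM (𝕜 := ℝ) S v⟫_ℝ / 2 + c)) *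
        ENNReal.ofReal (Real.exp (⟪v, x - θ⟫_ℝ -
          ⟪v, Matrix.toEuclideanCLM (𝕜 := ℝ) S v⟫_ℝ / 2)) ∂(multivariateGaussian θ S) := by
        refine lintegral_congr fun x => ?_
        rw [← ENNReal.ofReal_mul (Real.exp_pos _).le, ← Real.exp_add]
        congr 2
        ring
    _ = _ := by rw [lintegral_const_mul _ (by fun_prop), h, mul_one]

/-! ### The Kullback-Leibler divergence -/

theorem klDiv_withDensity_exp {α : Type*} [MeasurableSpace α] {μ ν : Measure α}
    [IsProbabilityMeasure μ] [IsProbabilityMeasure ν] {g : α → ℝ} (hg : Measurable g)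
    (hμ : μ = ν.withDensity fun x => ENNReal.ofReal (Real.exp (g x))) (hint : Integrable g μ) :
    InformationTheory.klDiv μ ν ≠ ∞ ∧ (InformationTheory.klDiv μ ν).toReal = ∫ x, g x ∂μ := by
  have hac : μ ≪ ν := hμ ▸ withDensity_absolutelyContinuous _ _
  have hllr : llr μ ν =ᵐ[μ] g := by
    refine hac.ae_le ?_
    have := Measure.rnDeriv_withDensity ν
      (by fun_prop : Measurable fun x => ENNReal.ofReal (Real.exp (g x)))
    rw [← hμ] at this
    filter_upwards [this] with x hx
    rw [llr, hx, ENNReal.toReal_ofReal (Real.exp_pos _).le, Real.log_exp]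
  refine ⟨InformationTheory.klDiv_ne_top hac (hint.congr hllr.symm), ?_⟩
  rw [InformationTheory.toReal_klDiv_of_measure_eq hac (by simp), integral_congr_ae hllr]

theorem integral_inner_sub_multivariateGaussian {d : ℕ} (θ θ' v : EuclideanSpace ℝ (Fin d))
    (S : Matrix (Fin d) (Fin d) ℝ) :
    Integrable (fun x => ⟪v, x - θ'⟫_ℝ) (multivariateGaussian θ S) ∧
      ∫ x, ⟪v, x - θ'⟫_ℝ ∂(multivariateGaussian θ S) = ⟪v, θ - θ'⟫_ℝ := by
  have hid : Integrable (fun x => x) (multivariateGaussian θ S) := IsGaussian.integrable_fun_id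
  have hi : Integrable (fun x => x - θ') (multivariateGaussian θ S) :=
    hid.sub (integrable_const _)
  refine ⟨hi.const_inner v, ?_⟩
  rw [integral_inner hi, integral_sub hid (integrable_const _), integral_id_multivariateGaussian]
  simp

theorem toEuclideanCLM_mul_inv_apply {d : ℕ} {S : Matrix (Fin d) (Fin d) ℝ} (hS : S.PosDef)
    (v : EuclideanSpace ℝ (Fin d)) :
    Matrix.toEuclideanCLM (𝕜 := ℝ) S (Matrix.toEuclideanCLM (𝕜 := ℝ) S⁻¹ v) = v := by
  rw [← ContinuousLinearMap.comp_apply, ← ContinuousLinearMap.mul_def, ← map_mul,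
    Matrix.mul_nonsing_inv _ ((Matrix.isUnit_iff_isUnit_det _).1 hS.isUnit), map_one]
  rfl

theorem toEuclideanCLM_inv_mul_apply {d : ℕ} {S : Matrix (Fin d) (Fin d) ℝ} (hS : S.PosDef)
    (v : EuclideanSpace ℝ (Fin d)) :
    Matrix.toEuclideanCLM (𝕜 := ℝ) S⁻¹ (Matrix.toEuclideanCLM (𝕜 := ℝ) S v) = v := by
  rw [← ContinuousLinearMap.comp_apply, ← ContinuousLinearMap.mul_def, ← map_mul,
    Matrix.nonsing_inv_mul _ ((Matrix.isUnit_iff_isUnit_det _).1 hS.isUnit), map_one]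
  rfl

theorem inner_toEuclideanCLM_comm {d : ℕ} {M : Matrix (Fin d) (Fin d) ℝ} (hM : M.PosDef)
    (v w : EuclideanSpace ℝ (Fin d)) :
    ⟪Matrix.toEuclideanCLM (𝕜 := ℝ) M v, w⟫_ℝ = ⟪v, Matrix.toEuclideanCLM (𝕜 := ℝ) M w⟫_ℝ := by
  have h := (IsSelfAdjoint.map (f := Matrix.toEuclideanCLM (n := Fin d) (𝕜 := ℝ))
    (show IsSelfAdjoint M from hM.isHermitian)).adjoint_eq
  conv_lhs => rw [← h]
  exact ContinuousLinearMap.adjoint_inner_left _ _ _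

theorem inner_toEuclideanCLM_pos {d : ℕ} {M : Matrix (Fin d) (Fin d) ℝ} (hM : M.PosDef)
    {v : EuclideanSpace ℝ (Fin d)} (hv : v ≠ 0) :
    0 < ⟪v, Matrix.toEuclideanCLM (𝕜 := ℝ) M v⟫_ℝ := by
  rw [Matrix.inner_toEuclideanCLM]
  have h := hM.dotProduct_mulVec_pos (x := v.ofLp) (by simpa using hv)
  simpa using h

section Gaussian

variable {d : ℕ} {θ₀ θ₁ : EuclideanSpace ℝ (Fin d)} {S : Matrix (Fin d) (Fin d) ℝ}

theorem multivariateGaussian_eq_withDensity (hS : S.PosDef) :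
    multivariateGaussian θ₁ S = (multivariateGaussian θ₀ S).withDensity fun x =>
      ENNReal.ofReal (Real.exp (⟪Matrix.toEuclideanCLM (𝕜 := ℝ) S⁻¹ (θ₁ - θ₀), x - θ₀⟫_ℝ -
        ⟪Matrix.toEuclideanCLM (𝕜 := ℝ) S⁻¹ (θ₁ - θ₀), θ₁ - θ₀⟫_ℝ / 2)) := by
  have h := multivariateGaussian_add θ₀ (Matrix.toEuclideanCLM (𝕜 := ℝ) S⁻¹ (θ₁ - θ₀))
    hS.posSemidef
  rw [toEuclideanCLM_mul_inv_apply hS, add_sub_cancel] at h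
  exact h

theorem gaussianKL_ne_top_and_toReal (hS : S.PosDef) :
    gaussianKL θ₁ θ₀ S ≠ ∞ ∧ (gaussianKL θ₁ θ₀ S).toReal =
      ⟪Matrix.toEuclideanCLM (𝕜 := ℝ) S⁻¹ (θ₁ - θ₀), θ₁ - θ₀⟫_ℝ / 2 := by
  obtain ⟨hi, hv⟩ := integral_inner_sub_multivariateGaussian θ₁ θ₀
    (Matrix.toEuclideanCLM (𝕜 := ℝ) S⁻¹ (θ₁ - θ₀)) S
  obtain ⟨h1, h2⟩ := klDiv_withDensity_exp (by fun_prop)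
    (multivariateGaussian_eq_withDensity (θ₀ := θ₀) (θ₁ := θ₁) hS) (hi.sub (integrable_const _))
  refine ⟨h1, h2.trans ?_⟩
  rw [integral_sub hi (integrable_const _), hv]
  simp only [integral_const, probReal_univ, one_smul]
  ring

/-! ### The Hyvärinen score of a Gaussian density -/

theorem log_gaussianDensity (hS : S.PosDef) (θ x : EuclideanSpace ℝ (Fin d)) :
    Real.log (gaussianDensity θ S x) =
      Real.log (Real.sqrt ((2 * Real.pi) ^ d * S.det))⁻¹ -
        ⟪x - θ, Matrix.toEuclideanCLM (𝕜 := ℝ) S⁻¹ (x - θ)⟫_ℝ / 2 := by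
  have hdet := hS.det_pos
  have h0 : (Real.sqrt ((2 * Real.pi) ^ d * S.det))⁻¹ ≠ 0 := by positivity
  rw [gaussianDensity, Real.log_mul h0 (Real.exp_pos _).ne', Real.log_exp,
    Matrix.inner_toEuclideanCLM]
  ring

theorem hasGradientAt_log_gaussianDensity (hS : S.PosDef) (θ x : EuclideanSpace ℝ (Fin d)) :
    HasGradientAt (fun y => Real.log (gaussianDensity θ S y))
      (-Matrix.toEuclideanCLM (𝕜 := ℝ) S⁻¹ (x - θ)) x := by
  simp_rw [log_gaussianDensity hS, div_eq_mul_inv]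
  set B := Matrix.toEuclideanCLM (n := Fin d) (𝕜 := ℝ) S⁻¹ with hB
  have h1 : HasFDerivAt (fun y : EuclideanSpace ℝ (Fin d) => y - θ)
      (ContinuousLinearMap.id ℝ _) x := (hasFDerivAt_id x).sub_const θ
  have h2 : HasFDerivAt (fun y => B (y - θ)) (B.comp (ContinuousLinearMap.id ℝ _)) x :=
    B.hasFDerivAt.comp x h1
  have h3 := (((h1.inner ℝ h2).mul_const (2⁻¹ : ℝ)).const_sub
    (Real.log (Real.sqrt ((2 * Real.pi) ^ d * S.det))⁻¹))
  rw [hasGradientAt_iff_hasFDerivAt]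
  convert! h3 using 1
  ext w
  have hc : ⟪x - θ, B w⟫_ℝ = ⟪B (x - θ), w⟫_ℝ := (inner_toEuclideanCLM_comm hS.inv _ _).symm
  simp [hc, real_inner_comm, inner_sub_right]
  ring

theorem laplacian_affine (v : EuclideanSpace ℝ (Fin d)) (c : ℝ) (x : EuclideanSpace ℝ (Fin d)) :
    Δ (fun y => ⟪v, y⟫_ℝ + c) x = 0 := by
  have h : fderiv ℝ (fun y => ⟪v, y⟫_ℝ + c) = fun _ => innerSL ℝ v := by
    ext1 y
    exact ((innerSL ℝ v).hasFDerivAt.add_const c).fderiv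
  rw [laplacian_eq_iteratedFDeriv_stdOrthonormalBasis]
  simp [iteratedFDeriv_two_apply, h]

theorem contDiff_log_gaussianDensity (hS : S.PosDef) (θ : EuclideanSpace ℝ (Fin d)) :
    ContDiff ℝ 2 fun y => Real.log (gaussianDensity θ S y) := by
  simp_rw [log_gaussianDensity hS]
  have h1 : ContDiff ℝ 2 fun y : EuclideanSpace ℝ (Fin d) => y - θ := by fun_prop
  have h2 := h1.inner ℝ ((Matrix.toEuclideanCLM (n := Fin d) (𝕜 := ℝ) S⁻¹).contDiff.comp h1)
  exact contDiff_const.sub (h2.div_const 2)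

/-- The quadratic part of the log density does not depend on the mean, so a change of mean adds only
an affine function. -/
theorem laplacian_log_gaussianDensity_eq (hS : S.PosDef) (θ θ' x : EuclideanSpace ℝ (Fin d)) :
    Δ (fun y => Real.log (gaussianDensity θ S y)) x =
      Δ (fun y => Real.log (gaussianDensity θ' S y)) x := by
  set B := Matrix.toEuclideanCLM (n := Fin d) (𝕜 := ℝ) S⁻¹ with hB
  have hfun : (fun y => Real.log (gaussianDensity θ S y)) =
      (fun y => Real.log (gaussianDensity θ' S y)) +
        fun y => ⟪B (θ - θ'), y⟫_ℝ + (⟪θ', B θ'⟫_ℝ - ⟪θ, B θ⟫_ℝ) / 2 := by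
    ext y
    simp only [Pi.add_apply, log_gaussianDensity hS, ← hB]
    have h1 : ⟪θ, B y⟫_ℝ = ⟪y, B θ⟫_ℝ := by
      rw [← inner_toEuclideanCLM_comm hS.inv, real_inner_comm]
    have h2 : ⟪θ', B y⟫_ℝ = ⟪y, B θ'⟫_ℝ := by
      rw [← inner_toEuclideanCLM_comm hS.inv, real_inner_comm]
    have h3 : ⟪B (θ - θ'), y⟫_ℝ = ⟪y, B θ⟫_ℝ - ⟪y, B θ'⟫_ℝ := by
      rw [real_inner_comm, map_sub, inner_sub_right]
    simp only [map_sub, inner_sub_left, inner_sub_right] at h3 ⊢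
    rw [h1, h2]
    linarith
  have haff : ContDiff ℝ 2 fun y : EuclideanSpace ℝ (Fin d) =>
      ⟪B (θ - θ'), y⟫_ℝ + (⟪θ', B θ'⟫_ℝ - ⟪θ, B θ⟫_ℝ) / 2 :=
    (contDiff_const.inner ℝ contDiff_id).add contDiff_const
  rw [hfun, ContDiffAt.laplacian_add (contDiff_log_gaussianDensity hS θ').contDiffAt
    haff.contDiffAt, laplacian_affine, add_zero]

theorem gaussianScore_eq (hS : S.PosDef) (lam : ℝ) (x : EuclideanSpace ℝ (Fin d)) :
    gaussianScore lam θ₀ θ₁ S x = lam *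
      (⟪Matrix.toEuclideanCLM (𝕜 := ℝ) S⁻¹ (Matrix.toEuclideanCLM (𝕜 := ℝ) S⁻¹ (θ₁ - θ₀)),
        x - θ₀⟫_ℝ - ‖Matrix.toEuclideanCLM (𝕜 := ℝ) S⁻¹ (θ₁ - θ₀)‖ ^ 2 / 2) := by
  simp only [gaussianScore, scusumScore, hyvarinenScore]
  rw [laplacian_log_gaussianDensity_eq hS θ₁ θ₀, (hasGradientAt_log_gaussianDensity hS θ₀ x).gradient,
    (hasGradientAt_log_gaussianDensity hS θ₁ x).gradient]
  set B := Matrix.toEuclideanCLM (n := Fin d) (𝕜 := ℝ) S⁻¹ with hB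
  have h1 : x - θ₁ = (x - θ₀) - (θ₁ - θ₀) := by abel
  rw [h1, map_sub B (x - θ₀), norm_neg, norm_neg, norm_sub_sq_real,
    inner_toEuclideanCLM_comm hS.inv (B (θ₁ - θ₀)), real_inner_comm]
  ring

theorem gaussianFisher_eq (hS : S.PosDef) :
    gaussianFisher θ₁ θ₀ S = ‖Matrix.toEuclideanCLM (𝕜 := ℝ) S⁻¹ (θ₁ - θ₀)‖ ^ 2 / 2 := by
  simp only [gaussianFisher, fisherDivergence]
  simp_rw [fun x => (hasGradientAt_log_gaussianDensity hS θ₀ x).gradient,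
    fun x => (hasGradientAt_log_gaussianDensity hS θ₁ x).gradient]
  have : ∀ x, -(Matrix.toEuclideanCLM (𝕜 := ℝ) S⁻¹) (x - θ₁) -
      -(Matrix.toEuclideanCLM (𝕜 := ℝ) S⁻¹) (x - θ₀) =
        Matrix.toEuclideanCLM (𝕜 := ℝ) S⁻¹ (θ₁ - θ₀) := fun x => by
    simp only [map_sub]
    abel
  simp_rw [this]
  simp
  ring

theorem isCalibrated_iff (hS : S.PosDef) {lam : ℝ} (hlam : 0 < lam) :
    IsCalibrated lam θ₀ θ₁ S ↔
      lam * ⟪Matrix.toEuclideanCLM (𝕜 := ℝ) S⁻¹ (θ₁ - θ₀), Matrix.toEuclideanCLM (𝕜 := ℝ) S⁻¹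
        (Matrix.toEuclideanCLM (𝕜 := ℝ) S⁻¹ (θ₁ - θ₀))⟫_ℝ =
      ‖Matrix.toEuclideanCLM (𝕜 := ℝ) S⁻¹ (θ₁ - θ₀)‖ ^ 2 := by
  rw [IsCalibrated]
  simp_rw [gaussianScore_eq hS]
  set B := Matrix.toEuclideanCLM (n := Fin d) (𝕜 := ℝ) S⁻¹ with hB
  set u := B (θ₁ - θ₀) with hu
  have h1 := lintegral_exp_multivariateGaussian θ₀ (lam • B u) hS.posSemidef
    (-(lam * (‖u‖ ^ 2 / 2)))
  rw [integral_eq_lintegral_of_nonneg_ae (Eventually.of_forall fun _ => (Real.exp_pos _).le)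
    (by fun_prop)]
  have h2 : ∀ x, lam * (⟪B u, x - θ₀⟫_ℝ - ‖u‖ ^ 2 / 2) =
      ⟪lam • B u, x - θ₀⟫_ℝ + -(lam * (‖u‖ ^ 2 / 2)) := fun x => by
    rw [real_inner_smul_left]
    ring
  simp_rw [h2]
  rw [h1, ENNReal.toReal_ofReal (Real.exp_pos _).le, Real.exp_eq_one_iff, map_smul,
    toEuclideanCLM_mul_inv_apply hS, real_inner_smul_left, real_inner_smul_right, real_inner_comm]
  -- The exponent is `lam (lam ⟪u, B u⟫ - ‖u‖²) / 2`; the root `lam = 0` is excluded by positivity.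
  constructor
  · intro h
    have : lam * (lam * ⟪u, B u⟫_ℝ - ‖u‖ ^ 2) = 0 := by linarith
    linarith [(mul_eq_zero.1 this).resolve_left hlam.ne']
  · intro h
    rw [h]
    ring

/-! ### Calibration and the comparison of the two divergences -/

theorem toEuclideanCLM_inv_sub_ne_zero (hS : S.PosDef) (hθ : θ₀ ≠ θ₁) :
    Matrix.toEuclideanCLM (𝕜 := ℝ) S⁻¹ (θ₁ - θ₀) ≠ 0 := fun h => by
  have := toEuclideanCLM_mul_inv_apply hS (θ₁ - θ₀)
  rw [h, map_zero] at this
  exact hθ (sub_eq_zero.1 this.symm).symm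

theorem existsUnique_isCalibrated (hS : S.PosDef) (hθ : θ₀ ≠ θ₁) :
    ∃! lam : ℝ, 0 < lam ∧ IsCalibrated lam θ₀ θ₁ S := by
  have hu := toEuclideanCLM_inv_sub_ne_zero hS hθ
  have hJ := inner_toEuclideanCLM_pos hS.inv hu
  have hpos := div_pos (pow_pos (norm_pos_iff.2 hu) 2) hJ
  refine ⟨_, ⟨hpos, (isCalibrated_iff hS hpos).2 (div_mul_cancel₀ _ hJ.ne')⟩, ?_⟩
  rintro lam ⟨h1, h2⟩
  exact eq_div_of_mul_eq hJ.ne' ((isCalibrated_iff hS h1).1 h2)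

theorem sub_smul_eq_zero_iff_eigenvector (hS : S.PosDef) (hθ : θ₀ ≠ θ₁) {lam : ℝ}
    (hlam : 0 < lam) (hc : IsCalibrated lam θ₀ θ₁ S) :
    θ₁ - θ₀ = lam • Matrix.toEuclideanCLM (𝕜 := ℝ) S⁻¹ (θ₁ - θ₀) ↔
      ∃ s : ℝ, Matrix.toEuclideanLin S (θ₁ - θ₀) = s • (θ₁ - θ₀) := by
  have hu := toEuclideanCLM_inv_sub_ne_zero hS hθ
  have hJ := inner_toEuclideanCLM_pos hS.inv hu
  rw [isCalibrated_iff hS hlam] at hc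
  rw [← Matrix.coe_toEuclideanCLM_eq_toEuclideanLin]
  simp only [ContinuousLinearMap.coe_coe]
  constructor
  · intro h
    refine ⟨lam, ?_⟩
    conv_lhs => rw [h]
    rw [map_smul, toEuclideanCLM_mul_inv_apply hS]
  · rintro ⟨s, hs⟩
    have h1 := toEuclideanCLM_inv_mul_apply hS (θ₁ - θ₀)
    rw [hs, map_smul] at h1
    -- An eigenvector of `S` for `s` gives `s • B u = u`, hence `s ⟪u, B u⟫ = ‖u‖²`, the calibration
    -- equation: the eigenvalue must be `lam`.
    have h2 : s = lam := by
      refine mul_right_cancel₀ hJ.ne' ?_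
      rw [hc, ← real_inner_smul_right, ← map_smul, h1, real_inner_self_eq_norm_sq]
    rw [← h2, h1]

/-- Expanding the square gives `⟪δ, B δ⟫ - 2 lam ‖B δ‖² + lam² ⟪B δ, B (B δ)⟫`; calibration turns
the last term into `lam ‖B δ‖²`. -/
theorem gaussianKL_sub_mul_gaussianFisher (hS : S.PosDef) {lam : ℝ} (hlam : 0 < lam)
    (hc : IsCalibrated lam θ₀ θ₁ S) :
    (gaussianKL θ₁ θ₀ S).toReal - lam * gaussianFisher θ₁ θ₀ S =
      ⟪θ₁ - θ₀ - lam • Matrix.toEuclideanCLM (𝕜 := ℝ) S⁻¹ (θ₁ - θ₀),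
        Matrix.toEuclideanCLM (𝕜 := ℝ) S⁻¹
          (θ₁ - θ₀ - lam • Matrix.toEuclideanCLM (𝕜 := ℝ) S⁻¹ (θ₁ - θ₀))⟫_ℝ / 2 := by
  rw [isCalibrated_iff hS hlam] at hc
  rw [(gaussianKL_ne_top_and_toReal hS).2, gaussianFisher_eq hS]
  generalize θ₁ - θ₀ = δ at hc ⊢
  set B := Matrix.toEuclideanCLM (n := Fin d) (𝕜 := ℝ) S⁻¹ with hB
  have h1 : ⟪δ, B (B δ)⟫_ℝ = ‖B δ‖ ^ 2 := by
    rw [← inner_toEuclideanCLM_comm hS.inv, real_inner_self_eq_norm_sq]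
  rw [map_sub, map_smul, inner_sub_left, inner_sub_right, inner_sub_right, real_inner_smul_left,
    real_inner_smul_left, real_inner_smul_right, real_inner_smul_right, hc, h1,
    real_inner_self_eq_norm_sq, real_inner_comm δ (B δ)]
  ring

theorem mul_gaussianFisher_le (hS : S.PosDef) (hθ : θ₀ ≠ θ₁) {lam : ℝ} (hlam : 0 < lam)
    (hc : IsCalibrated lam θ₀ θ₁ S) :
    lam * gaussianFisher θ₁ θ₀ S ≤ (gaussianKL θ₁ θ₀ S).toReal ∧
      (lam * gaussianFisher θ₁ θ₀ S = (gaussianKL θ₁ θ₀ S).toReal ↔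
        ∃ s : ℝ, Matrix.toEuclideanLin S (θ₁ - θ₀) = s • (θ₁ - θ₀)) := by
  have h := gaussianKL_sub_mul_gaussianFisher hS hlam hc
  rw [← sub_smul_eq_zero_iff_eigenvector hS hθ hlam hc, ← sub_eq_zero (a := θ₁ - θ₀)]
  by_cases hw : θ₁ - θ₀ - lam • Matrix.toEuclideanCLM (𝕜 := ℝ) S⁻¹ (θ₁ - θ₀) = 0
  · rw [hw, inner_zero_left, zero_div] at h
    exact ⟨by linarith, fun _ => hw, fun _ => by linarith⟩
  · have := inner_toEuclideanCLM_pos hS.inv hw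
    exact ⟨by linarith, fun h' => by linarith, fun h' => absurd h' hw⟩

/-- Along an eigenvector the calibrated score is the log-likelihood ratio. -/
theorem gaussianScore_eq_of_eigenvector (hS : S.PosDef) {lam : ℝ}
    (h : θ₁ - θ₀ = lam • Matrix.toEuclideanCLM (𝕜 := ℝ) S⁻¹ (θ₁ - θ₀))
    (x : EuclideanSpace ℝ (Fin d)) :
    gaussianScore lam θ₀ θ₁ S x = ⟪Matrix.toEuclideanCLM (𝕜 := ℝ) S⁻¹ (θ₁ - θ₀), x - θ₀⟫_ℝ -
      ⟪Matrix.toEuclideanCLM (𝕜 := ℝ) S⁻¹ (θ₁ - θ₀), θ₁ - θ₀⟫_ℝ / 2 := by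
  rw [gaussianScore_eq hS]
  set B := Matrix.toEuclideanCLM (n := Fin d) (𝕜 := ℝ) S⁻¹ with hB
  have h1 : lam * ⟪B (B (θ₁ - θ₀)), x - θ₀⟫_ℝ = ⟪B (θ₁ - θ₀), x - θ₀⟫_ℝ := by
    rw [← real_inner_smul_left, ← map_smul, ← h]
  have h2 : lam * ‖B (θ₁ - θ₀)‖ ^ 2 = ⟪B (θ₁ - θ₀), θ₁ - θ₀⟫_ℝ := by
    rw [← real_inner_self_eq_norm_sq, ← real_inner_smul_right, ← h]
  rw [mul_sub, h1, ← h2]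
  ring

/-- Under the post-change law the log-likelihood ratio is Gaussian with mean `D` and variance `2 D`,
where `D` is the Kullback–Leibler divergence. Both delay bounds use this moment generating function.
-/
theorem lintegral_exp_mul_loglikelihood (hS : S.PosDef) (s : ℝ) :
    ∫⁻ x, ENNReal.ofReal (Real.exp (s *
      (⟪Matrix.toEuclideanCLM (𝕜 := ℝ) S⁻¹ (θ₁ - θ₀), x - θ₀⟫_ℝ -
        ⟪Matrix.toEuclideanCLM (𝕜 := ℝ) S⁻¹ (θ₁ - θ₀), θ₁ - θ₀⟫_ℝ / 2)))
      ∂(multivariateGaussian θ₁ S) =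
    ENNReal.ofReal (Real.exp
      (⟪Matrix.toEuclideanCLM (𝕜 := ℝ) S⁻¹ (θ₁ - θ₀), θ₁ - θ₀⟫_ℝ / 2 * (s + s ^ 2))) := by
  set u := Matrix.toEuclideanCLM (n := Fin d) (𝕜 := ℝ) S⁻¹ (θ₁ - θ₀) with hu
  have h := lintegral_exp_multivariateGaussian θ₁ (s • u) hS.posSemidef
    (s * (⟪u, θ₁ - θ₀⟫_ℝ / 2))
  rw [map_smul, hu, toEuclideanCLM_mul_inv_apply hS, ← hu] at h
  have hx : ∀ x, s * (⟪u, x - θ₀⟫_ℝ - ⟪u, θ₁ - θ₀⟫_ℝ / 2) =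
      ⟪s • u, x - θ₁⟫_ℝ + s * (⟪u, θ₁ - θ₀⟫_ℝ / 2) := fun x => by
    have : x - θ₀ = x - θ₁ + (θ₁ - θ₀) := by abel
    rw [this, inner_add_right, real_inner_smul_left]
    ring
  simp_rw [hx]
  rw [h, real_inner_smul_left, real_inner_smul_right]
  congr 2
  ring

end Gaussian

end ScoreCusum

open ScoreCusum in
theorem mainTheorem3 {d : ℕ} (θ₀ θ₁ : EuclideanSpace ℝ (Fin d)) (hθ : θ₀ ≠ θ₁)
    {Ω : Type*} [MeasurableSpace Ω] (P : ℕ∞ → Measure Ω)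
    (X : ℕ → Ω → EuclideanSpace ℝ (Fin d)) :
    -- general covariance matrices
    (∀ S : Matrix (Fin d) (Fin d) ℝ, S.PosDef →
      gaussianKL θ₁ θ₀ S ≠ ∞ ∧
      (∃! lam : ℝ, 0 < lam ∧ IsCalibrated lam θ₀ θ₁ S) ∧
      ∀ lam : ℝ, 0 < lam → IsCalibrated lam θ₀ θ₁ S →
        lam * gaussianFisher θ₁ θ₀ S ≤ (gaussianKL θ₁ θ₀ S).toReal ∧
        (lam * gaussianFisher θ₁ θ₀ S = (gaussianKL θ₁ θ₀ S).toReal ↔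
          ∃ s : ℝ, Matrix.toEuclideanLin S (θ₁ - θ₀) = s • (θ₁ - θ₀))) ∧
    -- scalar covariance matrices
    (∀ (σc : ℝ) (S : Matrix (Fin d) (Fin d) ℝ), 0 < σc → S = σc • (1 : Matrix (Fin d) (Fin d) ℝ) →
      ∀ lam : ℝ, 0 < lam → IsCalibrated lam θ₀ θ₁ S →
        lam * gaussianFisher θ₁ θ₀ S = (gaussianKL θ₁ θ₀ S).toReal ∧
        ∀ hM : IsChangePointModel P X (multivariateGaussian θ₀ S) (multivariateGaussian θ₁ S),
          (∀ τ : ℝ, 0 < τ →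
            IsStoppingTime (obsFiltration X hM.measurable) (scusumTime lam θ₀ θ₁ S X τ)) ∧
          (∀ γ : ℝ, 1 < γ →
            ENNReal.ofReal γ ≤ arl P (scusumTime lam θ₀ θ₁ S X (Real.log γ))) ∧
          ∀ τ : ℝ → ℝ,
            (∀ᶠ γ in atTop, 0 < τ γ ∧ τ γ ≤ Real.log γ ∧
              ENNReal.ofReal γ ≤ arl P (scusumTime lam θ₀ θ₁ S X (τ γ))) →
            AsympEquiv
              (fun γ => wadd P (obsFiltration X hM.measurable) (scusumTime lam θ₀ θ₁ S X (τ γ)))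
              (fun γ => cadd P (scusumTime lam θ₀ θ₁ S X (τ γ))) ∧
            AsympEquiv
              (fun γ => cadd P (scusumTime lam θ₀ θ₁ S X (τ γ)))
              (fun γ => ENNReal.ofReal (Real.log γ) / gaussianKL θ₁ θ₀ S) ∧
            AsympEquiv
              (fun γ => wadd P (obsFiltration X hM.measurable) (scusumTime lam θ₀ θ₁ S X (τ γ)))
              (fun γ => ENNReal.ofReal (Real.log γ) / gaussianKL θ₁ θ₀ S) ∧
            AsympEquiv
              (fun γ => wadd P (obsFiltration X hM.measurable) (scusumTime lam θ₀ θ₁ S X (τ γ)))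
              (optimalDelay P (obsFiltration X hM.measurable)
                (wadd P (obsFiltration X hM.measurable))) ∧
            AsympEquiv
              (fun γ => cadd P (scusumTime lam θ₀ θ₁ S X (τ γ)))
              (optimalDelay P (obsFiltration X hM.measurable) (cadd P))) := by
  refine ⟨fun S hS => ⟨(gaussianKL_ne_top_and_toReal hS).1, existsUnique_isCalibrated hS hθ,
    fun lam hlam hc => mul_gaussianFisher_le hS hθ hlam hc⟩, ?_⟩
  intro σc S hσ hSσ lam hlam hc
  have hS : S.PosDef := hSσ ▸ Matrix.PosDef.one.smul hσ
  have heig : ∃ s : ℝ, Matrix.toEuclideanLin S (θ₁ - θ₀) = s • (θ₁ - θ₀) := by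
    refine ⟨σc, ?_⟩
    rw [hSσ, map_smul, ← Matrix.coe_toEuclideanCLM_eq_toEuclideanLin, map_one]
    rfl
  refine ⟨(mul_gaussianFisher_le hS hθ hlam hc).2.2 heig, fun hM => ?_⟩
  set u := Matrix.toEuclideanCLM (n := Fin d) (𝕜 := ℝ) S⁻¹ (θ₁ - θ₀) with hu
  have hscore := funext (gaussianScore_eq_of_eigenvector hS
    ((sub_smul_eq_zero_iff_eigenvector hS hθ hlam hc).2 heig))
  rw [← hu] at hscore
  have hz : Measurable (gaussianScore lam θ₀ θ₁ S) := by
    rw [hscore]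
    fun_prop
  have hP : multivariateGaussian θ₁ S = (multivariateGaussian θ₀ S).withDensity fun x =>
      ENNReal.ofReal (Real.exp (gaussianScore lam θ₀ θ₁ S x)) := by
    rw [hscore]
    exact multivariateGaussian_eq_withDensity hS
  obtain ⟨hKL, hKL'⟩ := gaussianKL_ne_top_and_toReal (θ₀ := θ₀) (θ₁ := θ₁) hS
  have hD : 0 < inner ℝ u (θ₁ - θ₀) / 2 := by
    have h := inner_toEuclideanCLM_pos hS.inv (sub_ne_zero.2 hθ.symm)
    rw [← hu, real_inner_comm] at h
    linarith
  rw [show gaussianKL θ₁ θ₀ S = ENNReal.ofReal (inner ℝ u (θ₁ - θ₀) / 2) by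
    rw [hu, ← hKL', ENNReal.ofReal_toReal hKL]]
  refine ⟨fun τ _ => isStoppingTime_cusumTime hz hM.measurable τ,
    fun γ hγ => hM.le_arl_cusumTime hz hP (by linarith), fun τ hτ => ?_⟩
  refine hM.asympEquiv_cusumTime hz hP hD (fun s => ?_) hτ
  rw [hscore]
  exact lintegral_exp_mul_loglikelihood hS s
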